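/- Let $R$ be a ring and $N\in\mathbb N$. Write $\mathrm C_N(\mathrm{Mod}_R)$ for the category of $N$-complexes of $R$-modules, i.e. sequences $(X^i,d\colon X^i\to X^{i+1})_{i\in\mathbb Z}$ with $d^N=0$, with the obvious morphisms. For $0\le k\le N$ let $\mu_k^i(R)$ be the $N$-complex that equals $R$ in the degrees $i-k+1,\dots,i$ and $0$ elsewhere, with identity differentials between copies of $R$. The homotopy category $\mathrm K_N(\mathrm{Mod}_R)$ has the same objects as $\mathrm C_N(\mathrm{Mod}_R)$, and $$\mathrm K_N(\mathrm{Mod}_R)(X,Y)=\mathrm C_N(\mathrm{Mod}_R)(X,Y)/\mathcal I(X,Y),$$ where $\mathcal I$ is the ideal of morphisms that factor through an object which is both injective and projective for the exact structure of levelwise split short exact sequences. For $1\le r\le N-1$ put $H^i_{(r)}(X)=\ker(d^r\colon X^i\to X^{i+r})/\mathrm{im}(d^{N-r}\colon X^{i-N+r}\to X^i)$. A morphism is an $N$-quasi-isomorphism if it induces isomorphisms on all $H^i_{(r)}$ ($i\in\mathbb Z$, $1\le r\le N-1$), and $X$ is acyclic if all these $H^i_{(r)}(X)$ vanish. An object $X$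 is h-projective if $\mathrm K_N(\mathrm{Mod}_R)(X,Y)=0$ for every acyclic $Y$; $\mathrm{h\text{-}proj}_N(\mathrm{Mod}_R)$ is the full subcategory of $\mathrm K_N(\mathrm{Mod}_R)$ on the h-projective objects. Let $J=\{0\to\mu_N^i(R)\mid i\in\mathbb Z\}$ and $I=J\cup\{\mu_r^i(R)\to\mu_N^i(R)\mid i\in\mathbb Z,\ 0<r<N\}$, where the maps in the second set are the identity of $R$ in the degrees in which both sides are $R$. **Theorem.** There is a model structure on $\mathrm C_N(\mathrm{Mod}_R)$ whose weak equivalences are the $N$-quasi-isomorphisms, whose fibrations are the morphisms with the right lifting property with respect to $J$, and whose cofibrations are the morphisms with the left lifting property with respect to all morphisms that have the right lifting property with respect to $I$. For this model structure: 1. Every cofibrant object is h-projective. 2. For morphisms $f,g\colon X\to Y$ between cofibrant objects the following are equivalent: $f$ and $g$ are left homotopic; $f$ and $g$ are right homotopic; $f-g$ is zero in $\mathrm K_N(\mathrm{Mod}_R)$; $f-g$ is nullhomotopic, i.e. there are $s^j\colon X^j\to Y^{j-N+1}$ ($j\in\mathbb Z$) with $f^i-g^i=\sum_{j=0}^{N-1}d^{N-j-1}\circ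 s^{i+j}\circ d^{j}$ for all $i\in\mathbb Z$. 3. Let $\mathrm C_N(\mathrm{Mod}_R)^{cf}_{/\sim}$ be the category of fibrant-cofibrant objects modulo the homotopy relation $\sim$ of the model structure. There is an equivalence of categories $$\mathrm C_N(\mathrm{Mod}_R)^{cf}_{/\sim}\xrightarrow{\ \sim\ }\mathrm{h\text{-}proj}_N(\mathrm{Mod}_R)$$ induced by the identity of $\mathrm C_N(\mathrm{Mod}_R)$: its composite with $\mathrm C_N(\mathrm{Mod}_R)^{cf}\to\mathrm C_N(\mathrm{Mod}_R)^{cf}_{/\sim}$ and with the inclusion $\mathrm{h\text{-}proj}_N(\mathrm{Mod}_R)\subset\mathrm K_N(\mathrm{Mod}_R)$ is the inclusion $\mathrm C_N(\mathrm{Mod}_R)^{cf}\subset\mathrm C_N(\mathrm{Mod}_R)$ followed by the projection to $\mathrm K_N(\mathrm{Mod}_R)$. -/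

import Mathlib

open CategoryTheory CategoryTheory.Limits HomotopicalAlgebra

open scoped ZeroObject

universe v u

/-! ### The category of `N`-complexes -/

set_option linter.unusedSectionVars false

section Complexes

/-- An `∞`-complex in `C` is a functor from the poset `ℤ` to `C`; it is an `N`-complex
if all the `N`-fold composites `X i ⟶ X (i + N)` of the differential vanish. -/
noncomputable def isNComplex (C : Type u) [Category.{v} C] [HasZeroMorphisms C] (N : ℕ) :
    ObjectProperty (ℤ ⥤ C) :=
  fun X => ∀ i : ℤ, X.map (homOfLE (by omega : i ≤ i + (N : ℤ))) = 0

/-- The category of `N`-complexes in `C`. -/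
abbrev NComplex (C : Type u) [Category.{v} C] [HasZeroMorphisms C] (N : ℕ) :=
  (isNComplex C N).FullSubcategory

namespace NComplex

variable {C : Type u} [Category.{v} C] [HasZeroMorphisms C] {N : ℕ}

/-- The object of the `N`-complex `X` in degree `i`. -/
abbrev deg (X : NComplex C N) (i : ℤ) : C := X.obj.obj i

/-- The component of a morphism in degree `i`. -/
abbrev component {X Y : NComplex C N} (f : X ⟶ Y) (i : ℤ) : X.deg i ⟶ Y.deg i :=
  f.hom.app i

/-- The power `d ^ (j - i) : X i ⟶ X j` of the differential, for `i ≤ j`. -/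
noncomputable abbrev dPow (X : NComplex C N) (i j : ℤ) (h : i ≤ j) : X.deg i ⟶ X.deg j :=
  X.obj.map (homOfLE h)

lemma dPow_eq_zero (X : NComplex C N) (i j : ℤ) (h : i ≤ j) (hN : i + N ≤ j) :
    X.dPow i j h = 0 := by
  have : X.dPow i j h = X.dPow i (i + N) (by omega) ≫ X.dPow (i + N) j hN := by
    rw [dPow, dPow, dPow, ← X.obj.map_comp]
    rfl
  rw [this, dPow, X.property i, zero_comp]

/-- The object in degree `j` of `μ_k^i(M)`: it is `M` in the `k` degrees `i - k + 1, …, i` and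
zero elsewhere. -/
noncomputable def muObj [HasZeroObject C] (M : C) (k : ℕ) (i j : ℤ) : C :=
  if i - k < j ∧ j ≤ i then M else 0

lemma muObj_eq [HasZeroObject C] (M : C) {k : ℕ} {i j : ℤ} (h : i - k < j ∧ j ≤ i) :
    muObj M k i j = M :=
  if_pos h

lemma isZero_muObj [HasZeroObject C] (M : C) {k : ℕ} {i j : ℤ} (h : ¬ (i - k < j ∧ j ≤ i)) :
    IsZero (muObj M k i j) := by
  rw [muObj, if_neg h]
  exact isZero_zero C

/-- The morphism from `μ_k^i(M)` in degree `a` to `μ_l^i(M)` in degree `b` which is the identity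
of `M` if both are `M`, and zero otherwise. -/
noncomputable def muHom [HasZeroObject C] (M : C) (k l : ℕ) (i a b : ℤ) :
    muObj M k i a ⟶ muObj M l i b :=
  if h : (i - k < a ∧ a ≤ i) ∧ (i - l < b ∧ b ≤ i) then
    eqToHom ((muObj_eq M h.1).trans (muObj_eq M h.2).symm)
  else 0

lemma muHom_self [HasZeroObject C] (M : C) (k : ℕ) (i a : ℤ) :
    muHom M k k i a a = 𝟙 _ := by
  by_cases h : i - k < a ∧ a ≤ i
  · rw [muHom, dif_pos ⟨h, h⟩, eqToHom_refl]
  · exact (isZero_muObj M h).eq_of_src _ _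

lemma muHom_comp [HasZeroObject C] (M : C) (k l m : ℕ) (i a b c : ℤ)
    (h : i - k < a → c ≤ i → i - l < b ∧ b ≤ i) :
    muHom M k l i a b ≫ muHom M l m i b c = muHom M k m i a c := by
  by_cases ha : i - k < a ∧ a ≤ i
  · by_cases hc : i - m < c ∧ c ≤ i
    · have hb := h ha.1 hc.2
      rw [muHom, muHom, muHom, dif_pos ⟨ha, hb⟩, dif_pos ⟨hb, hc⟩, dif_pos ⟨ha, hc⟩, eqToHom_trans]
    · exact (isZero_muObj M hc).eq_of_tgt _ _
  · exact (isZero_muObj M ha).eq_of_src _ _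

/-- The functor underlying `μ_k^i(M)`: the differentials between copies of `M` are identities. -/
noncomputable def muFunctor [HasZeroObject C] (M : C) (k : ℕ) (i : ℤ) : ℤ ⥤ C where
  obj j := muObj M k i j
  map {a b} _ := muHom M k k i a b
  map_id a := muHom_self M k i a
  map_comp {a b c} f g := by
    have hab := leOfHom f
    have hbc := leOfHom g
    exact (muHom_comp M k k k i a b c (by omega)).symm

/-- The `N`-complex `μ_k^i(M)`, for `k ≤ N`. -/
noncomputable def mu [HasZeroObject C] (N : ℕ) (M : C) (k : ℕ) (hk : k ≤ N) (i : ℤ) :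
    NComplex C N where
  obj := muFunctor M k i
  property j := dif_neg (by omega)

/-- For `r ≤ k`, the morphism of functors underlying `μ_r^i(M) ⟶ μ_k^i(M)`, which is the identity
of `M` in the degrees where both sides are `M` and zero in the other degrees. -/
noncomputable def muFunctorι [HasZeroObject C] (M : C) (r k : ℕ) (hr : r ≤ k) (i : ℤ) :
    muFunctor M r i ⟶ muFunctor M k i where
  app j := muHom M r k i j j
  naturality a b f := by
    have hab := leOfHom f
    exact (muHom_comp M r r k i a b b (by omega)).trans
      (muHom_comp M r k k i a a b (by omega)).symm

/-- The morphism `ι_{i,r} : μ_r^i(M) ⟶ μ_N^i(M)`. -/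
noncomputable def muι [HasZeroObject C] (N : ℕ) (M : C) (r : ℕ) (hr : r ≤ N) (i : ℤ) :
    mu N M r hr i ⟶ mu N M N le_rfl i :=
  ObjectProperty.homMk (muFunctorι M r N hr i)

instance hasZeroObject [HasZeroObject C] : HasZeroObject (NComplex C N) where
  zero := by
    refine ⟨mu N (0 : C) 0 (Nat.zero_le _) 0, ?_⟩
    have hz : ∀ j : ℤ, IsZero ((mu N (0 : C) 0 (Nat.zero_le _) 0 : NComplex C N).deg j) :=
      fun j => isZero_muObj _ (by omega)
    rw [IsZero.iff_id_eq_zero]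
    ext j
    exact (hz j).eq_of_src _ _

end NComplex

end Complexes

/-! ### The levelwise split exact structure and the homotopy category -/

section Homotopy

variable {A : Type u} [Category.{v} A] [Preadditive A] {N : ℕ}

namespace NComplex

/-- Evaluation in degree `i`. -/
noncomputable abbrev evalDeg (A : Type u) [Category.{v} A] [Preadditive A] (N : ℕ) (i : ℤ) :
    NComplex A N ⥤ A :=
  (isNComplex A N).ι ⋙ (evaluation ℤ A).obj i

instance (i : ℤ) : (evalDeg A N i).Additive where

/-- The class `S_⊕` of levelwise split short exact sequences of `N`-complexes. -/
def LevelwiseSplit (S : ShortComplex (NComplex A N)) : Prop :=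
  ∀ i : ℤ, Nonempty (S.map (evalDeg A N i)).Splitting

/-- `S_⊕`-projective `N`-complexes. -/
def SplitProjective (P : NComplex A N) : Prop :=
  ∀ S : ShortComplex (NComplex A N), LevelwiseSplit S →
    ∀ f : P ⟶ S.X₃, ∃ g : P ⟶ S.X₂, g ≫ S.g = f

/-- `S_⊕`-injective `N`-complexes. -/
def SplitInjective (I : NComplex A N) : Prop :=
  ∀ S : ShortComplex (NComplex A N), LevelwiseSplit S →
    ∀ f : S.X₁ ⟶ I, ∃ g : S.X₂ ⟶ I, S.f ≫ g = f

/-- The morphisms which factor through an object that is both `S_⊕`-injective and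
`S_⊕`-projective. -/
def FactorsThroughProjInj {X Y : NComplex A N} (f : X ⟶ Y) : Prop :=
  ∃ P : NComplex A N, SplitProjective P ∧ SplitInjective P ∧
    ∃ (g : X ⟶ P) (h : P ⟶ Y), g ≫ h = f

/-- `f` is nullhomotopic: there are `s j : X j ⟶ Y (j - N + 1)` such that in each degree `i`
one has `f = ∑_{j = 0}^{N - 1} d ^ (N - j - 1) ∘ s (i + j) ∘ d ^ j`. -/
def Nullhomotopic {X Y : NComplex A N} (f : X ⟶ Y) : Prop :=
  ∃ s : ∀ j : ℤ, X.deg j ⟶ Y.deg (j - N + 1),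
    ∀ i : ℤ, component f i =
      ∑ j : Fin N, X.dPow i (i + (j : ℕ)) (by omega) ≫ s (i + (j : ℕ)) ≫
        Y.dPow (i + (j : ℕ) - N + 1) i (by omega)

/-- The homotopy relation: `f - g` lies in the ideal of morphisms factoring through an
`S_⊕`-injective-projective object. -/
def stableRel (A : Type u) [Category.{v} A] [Preadditive A] (N : ℕ) : HomRel (NComplex A N) :=
  fun _ _ f g => FactorsThroughProjInj (f - g)

instance closedUnderBinaryProducts [HasFiniteBiproducts A] :
    (isNComplex A N).IsClosedUnderBinaryProducts where
  limitsOfShape_le := by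
    rintro X ⟨p⟩ i
    have hl := isLimitOfPreserves ((evaluation ℤ A).obj (i + N)) p.isLimit
    refine hl.hom_ext fun j => ?_
    have h := p.prop_diag_obj j i
    have hn := (p.π.app j).naturality (homOfLE (by omega : i ≤ i + (N : ℤ)))
    rw [h, comp_zero] at hn
    rw [zero_comp]
    exact hn

instance hasBinaryBiproducts [HasFiniteBiproducts A] : HasBinaryBiproducts (NComplex A N) := by
  have : HasBinaryProducts (NComplex A N) :=
    hasLimitsOfShape_of_closedUnderLimits _ (isNComplex A N)
  exact HasBinaryBiproducts.of_hasBinaryProducts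

lemma SplitProjective.biprod [HasFiniteBiproducts A] {P Q : NComplex A N}
    (hP : SplitProjective P) (hQ : SplitProjective Q) : SplitProjective (P ⊞ Q) := by
  intro S hS f
  obtain ⟨g₁, h₁⟩ := hP S hS (biprod.inl ≫ f)
  obtain ⟨g₂, h₂⟩ := hQ S hS (biprod.inr ≫ f)
  exact ⟨biprod.desc g₁ g₂, biprod.hom_ext' _ _ (by simp [h₁]) (by simp [h₂])⟩

lemma SplitInjective.biprod [HasFiniteBiproducts A] {P Q : NComplex A N}
    (hP : SplitInjective P) (hQ : SplitInjective Q) : SplitInjective (P ⊞ Q) := by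
  intro S hS f
  obtain ⟨g₁, h₁⟩ := hP S hS (f ≫ biprod.fst)
  obtain ⟨g₂, h₂⟩ := hQ S hS (f ≫ biprod.snd)
  exact ⟨biprod.lift g₁ g₂, biprod.hom_ext _ _ (by simp [h₁]) (by simp [h₂])⟩

lemma factorsThroughProjInj_zero [HasZeroObject A] (X Y : NComplex A N) :
    FactorsThroughProjInj (0 : X ⟶ Y) := by
  refine ⟨0, fun S _ f => ⟨0, (isZero_zero _).eq_of_src _ _⟩,
    fun S _ f => ⟨0, (isZero_zero _).eq_of_tgt _ _⟩, 0, 0, ?_⟩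
  simp

lemma FactorsThroughProjInj.add [HasFiniteBiproducts A] {X Y : NComplex A N} {f g : X ⟶ Y}
    (hf : FactorsThroughProjInj f) (hg : FactorsThroughProjInj g) :
    FactorsThroughProjInj (f + g) := by
  obtain ⟨P, hP, hP', a, b, rfl⟩ := hf
  obtain ⟨Q, hQ, hQ', c, d, rfl⟩ := hg
  exact ⟨P ⊞ Q, hP.biprod hQ, hP'.biprod hQ', biprod.lift a c, biprod.desc b d, by simp⟩

lemma FactorsThroughProjInj.neg {X Y : NComplex A N} {f : X ⟶ Y}
    (hf : FactorsThroughProjInj f) : FactorsThroughProjInj (-f) := by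
  obtain ⟨P, hP, hP', a, b, rfl⟩ := hf
  exact ⟨P, hP, hP', a, -b, by simp⟩

instance stableRel_congruence [HasZeroObject A] [HasFiniteBiproducts A] :
    Congruence (stableRel A N) where
  equivalence :=
    { refl := fun f => by
        rw [stableRel, sub_self]
        exact factorsThroughProjInj_zero _ _
      symm := fun {f g} h => by
        have h' := FactorsThroughProjInj.neg h
        rwa [neg_sub] at h'
      trans := fun {f g k} h h' => by
        have h'' := FactorsThroughProjInj.add h h'
        rwa [sub_add_sub_cancel] at h'' }
  comp_left f g g' h := by
    obtain ⟨P, hP, hP', a, b, hab⟩ := h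
    exact ⟨P, hP, hP', f ≫ a, b, by rw [Category.assoc, hab, Preadditive.comp_sub]⟩
  comp_right g h := by
    obtain ⟨P, hP, hP', a, b, hab⟩ := h
    exact ⟨P, hP, hP', a, b ≫ g, by rw [← Category.assoc, hab, Preadditive.sub_comp]⟩

end NComplex

/-- The homotopy category `K_N(A)`: the stable category of `N`-complexes for the levelwise split
exact structure. -/
noncomputable abbrev KN (A : Type u) [Category.{v} A] [Preadditive A] (N : ℕ) :=
  CategoryTheory.Quotient (NComplex.stableRel A N)

namespace KN

lemma stableRel_add [HasFiniteBiproducts A] ⦃X Y : NComplex A N⦄ (f₁ f₂ g₁ g₂ : X ⟶ Y)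
    (hf : NComplex.stableRel A N f₁ f₂) (hg : NComplex.stableRel A N g₁ g₂) :
    NComplex.stableRel A N (f₁ + g₁) (f₂ + g₂) := by
  have h := NComplex.FactorsThroughProjInj.add hf hg
  rwa [sub_add_sub_comm] at h

noncomputable instance preadditive [HasZeroObject A] [HasFiniteBiproducts A] :
    Preadditive (KN A N) :=
  CategoryTheory.Quotient.preadditive _ stableRel_add

/-- The projection `C_N(A) ⥤ K_N(A)`. -/
noncomputable abbrev proj (A : Type u) [Category.{v} A] [Preadditive A] (N : ℕ) : NComplex A N ⥤ KN A N :=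
  CategoryTheory.Quotient.functor (NComplex.stableRel A N)

instance proj_additive [HasZeroObject A] [HasFiniteBiproducts A] : (proj A N).Additive :=
  CategoryTheory.Quotient.functor_additive _ stableRel_add

end KN

end Homotopy

/-! ### Cohomology and h-projective objects -/

section Cohomology

variable {A : Type u} [Category.{v} A] [Abelian A] {N : ℕ}

namespace NComplex

/-- The sequence `X (i - (N - r)) ⟶ X i ⟶ X (i + r)` given by `d ^ (N - r)` and `d ^ r`. -/
noncomputable def cohomologySequence (A : Type u) [Category.{v} A] [Abelian A] (N r : ℕ)
    (hr : r ≤ N) (i : ℤ) : NComplex A N ⥤ ShortComplex A where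
  obj X := ShortComplex.mk (X.dPow (i - (N - r)) i (by omega)) (X.dPow i (i + r) (by omega)) (by
    rw [dPow, dPow, ← X.obj.map_comp]
    exact X.dPow_eq_zero _ _ (by omega) (by omega))
  map f :=
    { τ₁ := component f _
      τ₂ := component f _
      τ₃ := component f _
      comm₁₂ := (f.hom.naturality _).symm
      comm₂₃ := (f.hom.naturality _).symm }

/-- The cohomology functor `H_(r)^i = ker (d ^ r) / im (d ^ (N - r))` in degree `i`. -/
noncomputable def cohomology (A : Type u) [Category.{v} A] [Abelian A] (N r : ℕ)
    (hr : r ≤ N) (i : ℤ) : NComplex A N ⥤ A :=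
  cohomologySequence A N r hr i ⋙ ShortComplex.homologyFunctor A

/-- `N`-quasi-isomorphisms: the morphisms inducing isomorphisms on all `H_(r)^i`, for `i ∈ ℤ` and
`1 ≤ r ≤ N - 1`. -/
def quasiIso (A : Type u) [Category.{v} A] [Abelian A] (N : ℕ) :
    MorphismProperty (NComplex A N) :=
  fun _ _ f => ∀ (i : ℤ) (r : ℕ) (_ : 0 < r) (hr : r < N),
    IsIso ((cohomology A N r hr.le i).map f)

/-- An `N`-complex is acyclic if all its cohomology objects `H_(r)^i`, for `i ∈ ℤ` and
`1 ≤ r ≤ N - 1`, vanish. -/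
def Acyclic (X : NComplex A N) : Prop :=
  ∀ (i : ℤ) (r : ℕ) (_ : 0 < r) (hr : r < N), IsZero ((cohomology A N r hr.le i).obj X)

end NComplex

/-- The h-projective objects of `K_N(A)`: those `X` with `K_N(A)(X, Y)` trivial for every
acyclic `Y`. -/
def hProj (A : Type u) [Category.{v} A] [Abelian A] (N : ℕ) : ObjectProperty (KN A N) :=
  fun X => ∀ Y : NComplex A N, Y.Acyclic → Subsingleton (X ⟶ (KN.proj A N).obj Y)

end Cohomology

/-! ### Generating (trivial) cofibrations for `N`-complexes of modules -/

section Generators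

variable (R : Type u) [Ring R] (N : ℕ)

/-- The set `J` of the morphisms `0 ⟶ μ_N^i(R)`, `i ∈ ℤ`. -/
noncomputable def generatingTrivialCofibrations :
    MorphismProperty (NComplex (ModuleCat.{u} R) N) :=
  MorphismProperty.ofHoms fun i : ℤ =>
    (0 : (0 : NComplex (ModuleCat.{u} R) N) ⟶ NComplex.mu N (ModuleCat.of R R) N le_rfl i)

/-- The set `I` consisting of `J` and of the morphisms `μ_r^i(R) ⟶ μ_N^i(R)`, `i ∈ ℤ`,
`0 < r < N`. -/
noncomputable def generatingCofibrations :
    MorphismProperty (NComplex (ModuleCat.{u} R) N) :=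
  generatingTrivialCofibrations R N ⊔
    MorphismProperty.ofHoms fun p : ℤ × { r : ℕ // 0 < r ∧ r < N } =>
      NComplex.muι N (ModuleCat.of R R) p.2.1 p.2.2.2.le p.1

end Generators

/-! ### Homology of short complexes of modules in terms of elements -/

section ShortComplexElements

variable {R : Type u} [Ring R]

/-! The whole argument rests on one family of objects, the disks `disk N M`, the products of the
`μ_N^a (M a)`. A morphism into a disk is an arbitrary graded linear map `X^a → M a`, and a morphism
out of it is an arbitrary graded linear map `M a → Y^(a-N+1)`. Disks are therefore projective and
injective for levelwise split sequences, and they are acyclic. Each `X` embeds levelwise split into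
a disk (`toDisk`), and each `Y` is a quotient of one (`fromDisk`). Hence every split injective is a
retract of a disk, a morphism is zero in `K_N` iff it is a graded map `s` followed by `fromDisk`,
and writing out that composite gives the nullhomotopy formula (`nullhomotopic_iff`).

For the model structure, morphisms out of `μ_k^i(R)` are elements killed by `d^k`. So lifting
against `J` means degreewise surjectivity, and lifting against `I` means being moreover a
quasi-isomorphism (`rlp_generatingCofibrations_iff`). The same description makes the sources small.
The remaining point, that maps with the left lifting property against fibrations are
quasi-isomorphisms, follows by lifting against `A ⊞ disk → B`.

If `Y` is acyclic, `fromDisk` is a trivial fibration onto `Y`, so a morphism from a cofibrant object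
to `Y` factors through a disk: cofibrant objects are h-projective. Right homotopies are compared
with `K_N` through the path object `Y ⊞ disk`, and conversely by lifting along quasi-isomorphisms in
`K_N` (`hProj.exists_lift`). The same lifting makes quasi-isomorphisms between h-projectives
invertible in `K_N`, so an h-projective object is isomorphic there to its cofibrant replacement. -/

lemma homologyπ_eq_zero_iff (S : ShortComplex (ModuleCat.{u} R)) (z : S.cycles) :
    S.homologyπ z = 0 ↔ ∃ y, S.f y = S.iCycles z := by
  have hex : (ShortComplex.mk S.toCycles S.homologyπ (by simp)).Exact :=
    ShortComplex.exact_of_g_is_cokernel _ S.homologyIsCokernel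
  have hi : Function.Injective S.iCycles := (ModuleCat.mono_iff_injective _).1 inferInstance
  have ht : ∀ y, S.iCycles (S.toCycles y) = S.f y := fun y =>
    ConcreteCategory.congr_hom S.toCycles_i y
  refine ⟨fun h => ?_, fun ⟨y, hy⟩ => ?_⟩
  · obtain ⟨y, hy⟩ := (ShortComplex.moduleCat_exact_iff _).1 hex z h
    exact ⟨y, by rw [← ht]; exact congrArg S.iCycles hy⟩
  · have : z = S.toCycles y := hi (by rw [ht, hy])
    rw [this]
    exact ConcreteCategory.congr_hom (S.toCycles_comp_homologyπ) y

lemma exists_cycle_of_g_eq_zero (S : ShortComplex (ModuleCat.{u} R)) (x : S.X₂) (hx : S.g x = 0) :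
    ∃ z : S.cycles, S.iCycles z = x :=
  (ShortComplex.moduleCat_exact_iff _).1
    (ShortComplex.exact_of_f_is_kernel (ShortComplex.mk S.iCycles S.g (by simp))
      S.cyclesIsKernel) x hx

/-- The two conjuncts are injectivity and surjectivity on homology, phrased with representatives so
that later arguments are plain diagram chases. -/
lemma isIso_homologyMap_iff_elements {S T : ShortComplex (ModuleCat.{u} R)} (φ : S ⟶ T) :
    IsIso (ShortComplex.homologyMap φ) ↔
      (∀ x : S.X₂, S.g x = 0 → ∀ y : T.X₁, T.f y = φ.τ₂ x → ∃ x' : S.X₁, S.f x' = x) ∧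
      (∀ y : T.X₂, T.g y = 0 → ∃ x : S.X₂, S.g x = 0 ∧ ∃ z : T.X₁, φ.τ₂ x + T.f z = y) := by
  have hπ : ∀ z : S.cycles, ShortComplex.homologyMap φ (S.homologyπ z) =
      T.homologyπ (ShortComplex.cyclesMap φ z) := fun z =>
    ConcreteCategory.congr_hom (ShortComplex.homologyπ_naturality φ) z
  have hi : ∀ z : S.cycles, T.iCycles (ShortComplex.cyclesMap φ z) = φ.τ₂ (S.iCycles z) :=
    fun z => ConcreteCategory.congr_hom (ShortComplex.cyclesMap_i φ) z
  have hg : ∀ (S : ShortComplex (ModuleCat.{u} R)) (z : S.cycles), S.g (S.iCycles z) = 0 :=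
    fun S z => ConcreteCategory.congr_hom S.iCycles_g z
  have hs : ∀ (S : ShortComplex (ModuleCat.{u} R)), Function.Surjective S.homologyπ :=
    fun S => (ModuleCat.epi_iff_surjective _).1 inferInstance
  rw [ConcreteCategory.isIso_iff_bijective]
  refine ⟨fun ⟨hinj, hsurj⟩ => ⟨fun x hx y hy => ?_, fun y hy => ?_⟩,
    fun ⟨h₁, h₂⟩ => ⟨?_, fun w => ?_⟩⟩
  · obtain ⟨z, rfl⟩ := exists_cycle_of_g_eq_zero S x hx
    refine (homologyπ_eq_zero_iff S z).1 (hinj ?_)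
    rw [hπ, map_zero, homologyπ_eq_zero_iff]
    exact ⟨y, by rw [hy, hi]⟩
  · obtain ⟨z, rfl⟩ := exists_cycle_of_g_eq_zero T y hy
    obtain ⟨w, hw⟩ := hsurj (T.homologyπ z)
    obtain ⟨t, rfl⟩ := hs S w
    have h0 : T.homologyπ (z - ShortComplex.cyclesMap φ t) = 0 := by
      rw [map_sub, ← hπ, hw, sub_self]
    obtain ⟨a, ha⟩ := (homologyπ_eq_zero_iff T _).1 h0
    exact ⟨S.iCycles t, hg S t, a, by rw [ha, map_sub, hi]; abel⟩
  · rw [injective_iff_map_eq_zero]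
    intro w hw
    obtain ⟨z, rfl⟩ := hs S w
    rw [hπ, homologyπ_eq_zero_iff] at hw
    obtain ⟨y, hy⟩ := hw
    rw [hi] at hy
    rw [homologyπ_eq_zero_iff]
    exact h₁ _ (hg S z) y hy
  · obtain ⟨z, rfl⟩ := hs T w
    obtain ⟨x, hx, a, ha⟩ := h₂ _ (hg T z)
    obtain ⟨t, rfl⟩ := exists_cycle_of_g_eq_zero S x hx
    refine ⟨S.homologyπ t, ?_⟩
    rw [hπ, ← sub_eq_zero, ← map_sub, homologyπ_eq_zero_iff]
    exact ⟨-a, by rw [map_sub, hi, map_neg, ← ha]; abel⟩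

end ShortComplexElements

/-! ### `N`-complexes of modules in terms of elements -/

namespace NComplex

section Elements

variable {R : Type u} [Ring R] {N : ℕ}

lemma dPow_dPow (X : NComplex (ModuleCat.{u} R) N) {i j k : ℤ} (h : i ≤ j) (h' : j ≤ k)
    (x : X.deg i) : X.dPow j k h' (X.dPow i j h x) = X.dPow i k (h.trans h') x := by
  have : X.dPow i k (h.trans h') = X.dPow i j h ≫ X.dPow j k h' := by
    rw [dPow, dPow, dPow, ← X.obj.map_comp]
    rfl
  rw [this]
  rfl

lemma dPow_refl (X : NComplex (ModuleCat.{u} R) N) {i : ℤ} (h : i ≤ i) (x : X.deg i) :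
    X.dPow i i h x = x := by
  have : X.dPow i i h = 𝟙 _ := X.obj.map_id i
  rw [this]
  rfl

lemma dPow_apply_eq_zero (X : NComplex (ModuleCat.{u} R) N) {i j : ℤ} (h : i ≤ j)
    (hN : i + N ≤ j) (x : X.deg i) : X.dPow i j h x = 0 := by
  rw [X.dPow_eq_zero i j h hN]
  rfl

lemma component_dPow {X Y : NComplex (ModuleCat.{u} R) N} (f : X ⟶ Y) {i j : ℤ} (h : i ≤ j)
    (x : X.deg i) : component f j (X.dPow i j h x) = Y.dPow i j h (component f i x) :=
  ConcreteCategory.congr_hom (f.hom.naturality (homOfLE h)) x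

lemma component_comp {X Y Z : NComplex (ModuleCat.{u} R) N} (f : X ⟶ Y) (g : Y ⟶ Z) (i : ℤ)
    (x : X.deg i) : component (f ≫ g) i x = component g i (component f i x) :=
  rfl

lemma component_zero {X Y : NComplex (ModuleCat.{u} R) N} (i : ℤ)
    (x : X.deg i) : component (0 : X ⟶ Y) i x = 0 :=
  rfl

lemma component_id (X : NComplex (ModuleCat.{u} R) N) (i : ℤ)
    (x : X.deg i) : component (𝟙 X) i x = x :=
  rfl

lemma hom_ext_elements {X Y : NComplex (ModuleCat.{u} R) N} {f g : X ⟶ Y}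
    (h : ∀ i (x : X.deg i), component f i x = component g i x) : f = g := by
  ext i x
  exact h i x

/-- Constructor for `N`-complexes of modules. -/
noncomputable def ofModules (M : ℤ → ModuleCat.{u} R) (d : ∀ i j : ℤ, i ≤ j → (M i →ₗ[R] M j))
    (d_refl : ∀ i x, d i i le_rfl x = x)
    (d_d : ∀ i j k (h : i ≤ j) (h' : j ≤ k) x, d j k h' (d i j h x) = d i k (h.trans h') x)
    (d_zero : ∀ (i : ℤ) (h : i ≤ i + N) x, d i (i + N) h x = 0) :
    NComplex (ModuleCat.{u} R) N where
  obj :=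
    { obj := M
      map := fun {a b} f => ModuleCat.ofHom (d a b (leOfHom f))
      map_id := fun a => by ext x; exact d_refl a x
      map_comp := fun {a b c} f g => by
        ext x
        exact (d_d a b c (leOfHom f) (leOfHom g) x).symm }
  property := fun i => by ext x; exact d_zero i _ x

/-- Constructor for morphisms of `N`-complexes of modules. -/
noncomputable def homOfLinear {X Y : NComplex (ModuleCat.{u} R) N}
    (f : ∀ i : ℤ, X.deg i →ₗ[R] Y.deg i)
    (hf : ∀ i j (h : i ≤ j) (x : X.deg i), f j (X.dPow i j h x) = Y.dPow i j h (f i x)) :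
    X ⟶ Y :=
  ObjectProperty.homMk
    { app := fun i => ModuleCat.ofHom (f i)
      naturality := fun i j φ => by
        ext x
        exact hf i j (leOfHom φ) x }

lemma homOfLinear_apply {X Y : NComplex (ModuleCat.{u} R) N}
    (f : ∀ i : ℤ, X.deg i →ₗ[R] Y.deg i)
    (hf : ∀ i j (h : i ≤ j) (x : X.deg i), f j (X.dPow i j h x) = Y.dPow i j h (f i x))
    (i : ℤ) (x : X.deg i) : component (homOfLinear f hf) i x = f i x :=
  rfl

/-- The pair `(i, r)` is encoded by degrees `a < b < c` with `c = a + N`, where `b = i` and `r = c -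
b`. With free degrees, no transport along equalities of integers is needed. -/
lemma quasiIso_iff {X Y : NComplex (ModuleCat.{u} R) N} (f : X ⟶ Y) :
    quasiIso (ModuleCat.{u} R) N f ↔ ∀ (a b c : ℤ) (h : a < b) (h' : b < c), c = a + N →
      (∀ x : X.deg b, X.dPow b c h'.le x = 0 →
        ∀ y : Y.deg a, Y.dPow a b h.le y = component f b x → ∃ x', X.dPow a b h.le x' = x) ∧
      (∀ y : Y.deg b, Y.dPow b c h'.le y = 0 →
        ∃ x : X.deg b, X.dPow b c h'.le x = 0 ∧
          ∃ z : Y.deg a, component f b x + Y.dPow a b h.le z = y) := by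
  refine ⟨fun hf a b c h h' hc => ?_, fun hf i r hr hr' => ?_⟩
  · obtain ⟨r, rfl⟩ := Int.le.dest h'.le
    obtain rfl : a = b - (N - r) := by omega
    exact (isIso_homologyMap_iff_elements
      ((cohomologySequence (ModuleCat.{u} R) N r (by omega) b).map f)).1
        (hf b r (by omega) (by omega))
  · exact (isIso_homologyMap_iff_elements
      ((cohomologySequence (ModuleCat.{u} R) N r hr'.le i).map f)).2
        (hf (i - (N - r)) i (i + r) (by omega) (by omega) (by omega))

lemma acyclic_iff (X : NComplex (ModuleCat.{u} R) N) :
    X.Acyclic ↔ ∀ (a b c : ℤ) (h : a < b) (h' : b < c), c = a + N →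
      ∀ x : X.deg b, X.dPow b c h'.le x = 0 → ∃ x', X.dPow a b h.le x' = x := by
  have key : ∀ (i : ℤ) (r : ℕ) (hr : r ≤ N),
      IsZero ((cohomology (ModuleCat.{u} R) N r hr i).obj X) ↔
        ∀ x : X.deg i, X.dPow i (i + r) (by omega) x = 0 →
          ∃ x', X.dPow (i - (N - r)) i (by omega) x' = x := fun i r hr => by
    exact (ShortComplex.exact_iff_isZero_homology _).symm.trans (ShortComplex.moduleCat_exact_iff
      ((cohomologySequence (ModuleCat.{u} R) N r hr i).obj X))
  refine ⟨fun hf a b c h h' hc => ?_, fun hf i r hr hr' => ?_⟩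
  · obtain ⟨r, rfl⟩ := Int.le.dest h'.le
    obtain rfl : a = b - (N - r) := by omega
    exact (key b r (by omega)).1 (hf b r (by omega) (by omega))
  · exact (key i r hr'.le).2
      (hf (i - (N - r)) i (i + r) (by omega) (by omega) (by omega))

lemma quasiIso_of_acyclic {X Y : NComplex (ModuleCat.{u} R) N} (f : X ⟶ Y) (hX : X.Acyclic)
    (hY : Y.Acyclic) : quasiIso (ModuleCat.{u} R) N f := by
  rw [quasiIso_iff]
  intro a b c h h' hc
  refine ⟨fun x hx _ _ => (acyclic_iff X).1 hX a b c h h' hc x hx, fun y hy => ?_⟩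
  obtain ⟨z, hz⟩ := (acyclic_iff Y).1 hY a b c h h' hc y hy
  exact ⟨0, by simp, z, by simp [hz]⟩

/-- The objectwise characterization of the trivial fibrations. -/
lemma quasiIso_iff_of_surjective {X Y : NComplex (ModuleCat.{u} R) N} (f : X ⟶ Y)
    (hf : ∀ i, Function.Surjective (component f i)) :
    quasiIso (ModuleCat.{u} R) N f ↔ ∀ (a b c : ℤ) (h : a < b) (h' : b < c), c = a + N →
      ∀ (x : X.deg b) (y : Y.deg a), X.dPow b c h'.le x = 0 →
        Y.dPow a b h.le y = component f b x →
          ∃ x' : X.deg a, component f a x' = y ∧ X.dPow a b h.le x' = x := by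
  rw [quasiIso_iff]
  refine ⟨fun H a b c h h' hc x y hx hy => ?_, fun H a b c h h' hc => ⟨?_, ?_⟩⟩
  -- `x₀` has the right differential but perhaps the wrong image. The error `y - f x₀` is a cocycle,
  -- hence the image of a cocycle `x₁` plus a boundary `d z`, and `z` lifts by surjectivity. Neither
  -- correction changes the differential, by `d^N = 0`.
  · obtain ⟨x₀, hx₀⟩ := (H a b c h h' hc).1 x hx y hy
    obtain ⟨x₁, hx₁, z, hz⟩ := (H (b - N) a b (by omega) h (by omega)).2
      (y - component f a x₀) (by rw [map_sub, hy, ← component_dPow, hx₀, sub_self])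
    obtain ⟨w, rfl⟩ := hf _ z
    refine ⟨x₀ + x₁ + X.dPow _ a (by omega) w, ?_, ?_⟩
    · rw [map_add, map_add, component_dPow, add_assoc, hz]
      abel
    · rw [map_add, map_add, hx₀, hx₁, dPow_dPow, dPow_apply_eq_zero _ _ (by omega)]
      simp
  · intro x hx y hy
    obtain ⟨x', -, hx'⟩ := H a b c h h' hc x y hx hy
    exact ⟨x', hx'⟩
  · intro y hy
    -- The criterion one step up, for `b < c < b + N` and the element `0`, lifts a cocycle to a
    -- cocycle.
    obtain ⟨x', hx', hx''⟩ := H b c (b + N) h' (by omega) rfl 0 y (by simp) (by rw [hy, map_zero])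
    exact ⟨x', hx'', 0, by rw [map_zero, add_zero, hx']⟩

end Elements

end NComplex

/-! ### Contractible `N`-complexes on graded modules -/

namespace NComplex

section Disk

variable {R : Type u} [Ring R] {N : ℕ}

/-- The families which vanish outside of the interval `[j, j + N)`. -/
def windowSubmodule (N : ℕ) (M : ℤ → ModuleCat.{u} R) (j : ℤ) : Submodule R (∀ a, M a) where
  carrier := {m | ∀ a, ¬ (j ≤ a ∧ a < j + N) → m a = 0}
  add_mem' := fun {m m'} h h' a ha => by rw [Pi.add_apply, h a ha, h' a ha, add_zero]
  zero_mem' := fun _ _ => rfl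
  smul_mem' := fun r m h a ha => by rw [Pi.smul_apply, h a ha, smul_zero]

/-- Extension by zero of the restriction of a family to the interval `[j, j + N)`. -/
def window (N : ℕ) (M : ℤ → ModuleCat.{u} R) (j : ℤ) :
    (∀ a, M a) →ₗ[R] windowSubmodule N M j where
  toFun m := ⟨fun a => if j ≤ a ∧ a < j + N then m a else 0, fun _ ha => if_neg ha⟩
  map_add' m m' := by
    ext a
    simp only [Pi.add_apply, Submodule.coe_add]
    split_ifs <;> simp
  map_smul' r m := by
    ext a
    simp only [Pi.smul_apply, Submodule.coe_smul, RingHom.id_apply]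
    split_ifs <;> simp

lemma window_apply (M : ℤ → ModuleCat.{u} R) (j : ℤ) (m : ∀ a, M a) (a : ℤ) :
    (window N M j m).1 a = if j ≤ a ∧ a < j + N then m a else 0 :=
  rfl

/-- The contractible `N`-complex `∏ a, μ_N^a (M a)`. -/
noncomputable def disk (N : ℕ) (M : ℤ → ModuleCat.{u} R) : NComplex (ModuleCat.{u} R) N :=
  ofModules (fun j => ModuleCat.of R (windowSubmodule N M j))
    (fun i j _ => window N M j ∘ₗ (windowSubmodule N M i).subtype)
    (fun i x => by
      ext a
      simp only [LinearMap.comp_apply, Submodule.subtype_apply, window_apply]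
      split_ifs with h
      · rfl
      · exact (x.2 a h).symm)
    (fun i j k h h' x => by
      ext a
      simp only [LinearMap.comp_apply, Submodule.subtype_apply, window_apply]
      split_ifs with h₁ h₂
      · rfl
      · exact (x.2 a (by omega)).symm
      · rfl)
    (fun i h x => by
      ext a
      simp only [LinearMap.comp_apply, Submodule.subtype_apply, window_apply]
      split_ifs with h₁
      · exact x.2 a (by omega)
      · rfl)

variable {M : ℤ → ModuleCat.{u} R}

/-- The family underlying an element of a contractible `N`-complex. -/
noncomputable def diskVal (i : ℤ) : (disk N M).deg i →ₗ[R] ∀ a, M a :=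
  (windowSubmodule N M i).subtype

/-- The element of a contractible `N`-complex obtained by truncating a family. -/
noncomputable def diskMk (i : ℤ) : (∀ a, M a) →ₗ[R] (disk N M).deg i :=
  window N M i

lemma diskVal_diskMk (i : ℤ) (m : ∀ a, M a) (a : ℤ) :
    diskVal i (diskMk (N := N) i m) a = if i ≤ a ∧ a < i + N then m a else 0 :=
  rfl

lemma diskVal_dPow {i j : ℤ} (h : i ≤ j) (m : (disk N M).deg i) (a : ℤ) :
    diskVal j ((disk N M).dPow i j h m) a =
      if j ≤ a ∧ a < j + N then diskVal i m a else 0 :=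
  rfl

lemma diskVal_eq_zero {i : ℤ} (m : (disk N M).deg i) {a : ℤ} (h : ¬ (i ≤ a ∧ a < i + N)) :
    diskVal i m a = 0 :=
  Subtype.property (p := fun m => m ∈ windowSubmodule N M i) m a h

lemma disk_ext {i : ℤ} {m m' : (disk N M).deg i}
    (h : ∀ a, i ≤ a → a < i + N → diskVal i m a = diskVal i m' a) : m = m' := by
  refine Subtype.ext (p := fun m => m ∈ windowSubmodule N M i) (funext fun a => ?_)
  by_cases ha : i ≤ a ∧ a < i + N
  · exact h a ha.1 ha.2
  · exact (diskVal_eq_zero m ha).trans (diskVal_eq_zero m' ha).symm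

/-- The differential is truncation. A family of degree `b` that dies in degree `c = a + N` is
supported in `[b, a + N)`, so it is the truncation of the same family placed in degree `a`. -/
lemma acyclic_disk (N : ℕ) (M : ℤ → ModuleCat.{u} R) : (disk N M).Acyclic := by
  rw [acyclic_iff]
  rintro a b c h h' rfl x hx
  refine ⟨diskMk a (diskVal b x), disk_ext fun e he he' => ?_⟩
  rw [diskVal_dPow, if_pos ⟨he, he'⟩, diskVal_diskMk]
  split_ifs with h₁
  · rfl
  · have := congrArg (fun m => diskVal _ m e) hx
    simp only [diskVal_dPow] at this
    rw [if_pos (by omega), map_zero] at this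
    exact this.symm

/-- The power of the differential from degree `i` to degree `j`, extended by zero to all pairs of
degrees. -/
noncomputable def dExt (X : NComplex (ModuleCat.{u} R) N) (i j : ℤ) : X.deg i →ₗ[R] X.deg j :=
  if h : i ≤ j then (X.dPow i j h).hom else 0

lemma dExt_of_le (X : NComplex (ModuleCat.{u} R) N) {i j : ℤ} (h : i ≤ j) (x : X.deg i) :
    X.dExt i j x = X.dPow i j h x := by
  rw [dExt, dif_pos h]

lemma dExt_eq_zero (X : NComplex (ModuleCat.{u} R) N) {i j : ℤ} (h : i + N ≤ j) (x : X.deg i) :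
    X.dExt i j x = 0 := by
  rw [dExt_of_le X (by omega), dPow_apply_eq_zero _ _ h]

lemma component_dExt {X Y : NComplex (ModuleCat.{u} R) N} (f : X ⟶ Y) (i j : ℤ)
    (x : X.deg i) : component f j (X.dExt i j x) = Y.dExt i j (component f i x) := by
  by_cases h : i ≤ j
  · rw [dExt_of_le _ h, dExt_of_le _ h, component_dPow]
  · rw [dExt, dExt, dif_neg h, dif_neg h]
    simp

/-- The morphism to a contractible `N`-complex determined by a graded linear map. -/
noncomputable def diskLift {X : NComplex (ModuleCat.{u} R) N} (s : ∀ a, X.deg a →ₗ[R] M a) :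
    X ⟶ disk N M :=
  homOfLinear (fun j => diskMk j ∘ₗ LinearMap.pi fun a => s a ∘ₗ X.dExt j a)
    (fun i j h x => disk_ext fun a ha ha' => by
      rw [diskVal_dPow, if_pos ⟨ha, ha'⟩]
      simp only [LinearMap.comp_apply, diskVal_diskMk, LinearMap.pi_apply]
      rw [if_pos ⟨ha, ha'⟩, dExt_of_le _ ha, dPow_dPow, ← dExt_of_le]
      split_ifs with h₁
      · rfl
      · rw [dExt_eq_zero _ (by omega), map_zero])

lemma diskLift_val {X : NComplex (ModuleCat.{u} R) N} (s : ∀ a, X.deg a →ₗ[R] M a) (j : ℤ)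
    (x : X.deg j) (a : ℤ) :
    diskVal j (component (diskLift s) j x) a =
      if j ≤ a ∧ a < j + N then s a (X.dExt j a x) else 0 :=
  rfl

/-- The morphism from a contractible `N`-complex determined by a graded linear map. -/
noncomputable def diskDesc {Y : NComplex (ModuleCat.{u} R) N}
    (t : ∀ a : ℤ, M a →ₗ[R] Y.deg (a - N + 1)) : disk N M ⟶ Y :=
  homOfLinear (fun j => ∑ a ∈ Finset.Ico j (j + N),
      Y.dExt (a - N + 1) j ∘ₗ t a ∘ₗ LinearMap.proj a ∘ₗ diskVal j)
    (fun i j h m => by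
      simp only [LinearMap.comp_apply, LinearMap.sum_apply, map_sum, LinearMap.proj_apply]
      have h₁ : ∀ e, diskVal j ((disk N M).dPow i j h m) e =
          if j ≤ e then diskVal i m e else 0 := fun e => by
        rw [diskVal_dPow]
        by_cases he : j ≤ e
        · by_cases he' : e < j + N
          · simp [he, he']
          · simp only [he, he', if_true, if_false, and_false]
            exact (diskVal_eq_zero m (by omega)).symm
        · simp [he]
      calc
        _ = ∑ a ∈ Finset.Ico j (j + N), Y.dExt (a - N + 1) j (t a (diskVal i m a)) := by
          refine Finset.sum_congr rfl fun a ha => ?_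
          rw [h₁, if_pos (Finset.mem_Ico.1 ha).1]
        -- The added terms have `a < j`, so at least `N` differentials lead from degree `a - N + 1`
        -- to `j`.
        _ = ∑ a ∈ Finset.Ico i (j + N), Y.dExt (a - N + 1) j (t a (diskVal i m a)) := by
          refine Finset.sum_subset (Finset.Ico_subset_Ico_left h) fun a ha ha' => ?_
          rw [Finset.mem_Ico] at ha ha'
          exact dExt_eq_zero _ (by omega) _
        _ = ∑ a ∈ Finset.Ico i (i + N), Y.dExt (a - N + 1) j (t a (diskVal i m a)) := by
          refine (Finset.sum_subset (Finset.Ico_subset_Ico_right (by omega))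
            fun a ha ha' => ?_).symm
          rw [Finset.mem_Ico] at ha ha'
          rw [diskVal_eq_zero m (by omega), map_zero, map_zero]
        _ = _ := by
          refine Finset.sum_congr rfl fun a ha => ?_
          rw [Finset.mem_Ico] at ha
          rw [dExt_of_le _ (by omega : a - N + 1 ≤ j), dExt_of_le _ (by omega : a - N + 1 ≤ i),
            dPow_dPow])

lemma component_diskDesc {Y : NComplex (ModuleCat.{u} R) N}
    (t : ∀ a : ℤ, M a →ₗ[R] Y.deg (a - N + 1)) (j : ℤ) (m : (disk N M).deg j) :
    component (diskDesc t) j m =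
      ∑ a ∈ Finset.Ico j (j + N), Y.dExt (a - N + 1) j (t a (diskVal j m a)) := by
  rw [diskDesc, homOfLinear_apply]
  simp only [LinearMap.comp_apply, LinearMap.sum_apply, LinearMap.proj_apply]

lemma comp_diskLift {X X' : NComplex (ModuleCat.{u} R) N} (f : X' ⟶ X)
    (s : ∀ a, X.deg a →ₗ[R] M a) :
    f ≫ diskLift s = diskLift fun a => s a ∘ₗ (component f a).hom := by
  refine hom_ext_elements fun i x => disk_ext fun a _ _ => ?_
  rw [component_comp, diskLift_val, diskLift_val, ← component_dExt]
  rfl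

lemma diskDesc_comp {Y Y' : NComplex (ModuleCat.{u} R) N}
    (t : ∀ a : ℤ, M a →ₗ[R] Y.deg (a - N + 1)) (f : Y ⟶ Y') :
    diskDesc t ≫ f = diskDesc fun a => (component f _).hom ∘ₗ t a := by
  refine hom_ext_elements fun i x => ?_
  rw [component_comp, component_diskDesc, component_diskDesc, map_sum]
  exact Finset.sum_congr rfl fun a _ => component_dExt _ _ _ _

lemma component_diskLift_comp_diskDesc {X Y : NComplex (ModuleCat.{u} R) N}
    (s : ∀ a, X.deg a →ₗ[R] M a) (t : ∀ a : ℤ, M a →ₗ[R] Y.deg (a - N + 1)) (i : ℤ)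
    (x : X.deg i) : component (diskLift s ≫ diskDesc t) i x =
      ∑ a ∈ Finset.Ico i (i + N), Y.dExt (a - N + 1) i (t a (s a (X.dExt i a x))) := by
  rw [component_comp, component_diskDesc]
  refine Finset.sum_congr rfl fun a ha => ?_
  rw [diskLift_val, if_pos (Finset.mem_Ico.1 ha)]

/-- Coordinate `a` survives the differential up to degree `a`, so it can be read off there; this
forces the choice of `s a`. -/
lemma exists_eq_diskLift {X : NComplex (ModuleCat.{u} R) N} (f : X ⟶ disk N M) :
    ∃ s : ∀ a, X.deg a →ₗ[R] M a, f = diskLift s := by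
  refine ⟨fun a => LinearMap.proj a ∘ₗ diskVal a ∘ₗ (component f a).hom,
    hom_ext_elements fun i x => disk_ext fun a ha ha' => ?_⟩
  rw [diskLift_val, if_pos ⟨ha, ha'⟩, dExt_of_le _ ha]
  have h := congrArg (fun m => diskVal a m a) (component_dPow f ha x)
  simp only [diskVal_dPow] at h
  rw [if_pos (by omega)] at h
  exact h.symm

/-- The inclusion of `M a` in the lowest degree in which it contributes. -/
noncomputable def diskSingle (N : ℕ) (M : ℤ → ModuleCat.{u} R) (a : ℤ) :
    M a →ₗ[R] (disk N M).deg (a - N + 1) :=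
  diskMk (a - N + 1) ∘ₗ LinearMap.single R (fun a => M a) a

lemma diskVal_diskSingle (a : ℤ) (x : M a) (b : ℤ) :
    diskVal _ (diskSingle N M a x) b =
      if a - N + 1 ≤ b ∧ b < a - N + 1 + N then (Pi.single a x : ∀ a, M a) b else 0 :=
  rfl

/-- With the naturality of `diskDesc`, this shows that every morphism out of a disk is of the form
`diskDesc t`. -/
lemma diskDesc_diskSingle : diskDesc (diskSingle N M) = 𝟙 (disk N M) := by
  refine hom_ext_elements fun j m => disk_ext fun e he he' => ?_
  rw [component_diskDesc, component_id, map_sum, Finset.sum_apply, Finset.sum_eq_single e]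
  · rw [dExt_of_le _ (by omega), diskVal_dPow, if_pos ⟨he, he'⟩, diskVal_diskSingle,
      if_pos (by omega), Pi.single_eq_same]
  · intro a ha hae
    rw [Finset.mem_Ico] at ha
    rw [dExt_of_le _ (by omega), diskVal_dPow, if_pos ⟨he, he'⟩, diskVal_diskSingle,
      Pi.single_eq_of_ne hae.symm, ite_self]
  · intro h
    exact absurd (Finset.mem_Ico.2 ⟨he, he'⟩) h

lemma exists_eq_diskDesc {Y : NComplex (ModuleCat.{u} R) N} (f : disk N M ⟶ Y) :
    ∃ t : ∀ a : ℤ, M a →ₗ[R] Y.deg (a - N + 1), f = diskDesc t :=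
  ⟨_, by rw [← diskDesc_comp, diskDesc_diskSingle, Category.id_comp]⟩

/-- Morphisms out of a disk are mere graded maps, so degreewise sections suffice for lifting even
though they need not commute with the differential. Dually for injectivity. -/
lemma splitProjective_disk (N : ℕ) (M : ℤ → ModuleCat.{u} R) : SplitProjective (disk N M) := by
  intro S hS f
  obtain ⟨t, rfl⟩ := exists_eq_diskDesc f
  refine ⟨diskDesc fun a => (hS (a - N + 1)).some.s.hom ∘ₗ t a, ?_⟩
  rw [diskDesc_comp]
  congr 1
  funext a
  ext x
  exact ConcreteCategory.congr_hom (hS (a - N + 1)).some.s_g (t a x)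

lemma splitInjective_disk (N : ℕ) (M : ℤ → ModuleCat.{u} R) : SplitInjective (disk N M) := by
  intro S hS f
  obtain ⟨s, rfl⟩ := exists_eq_diskLift f
  refine ⟨diskLift fun a => s a ∘ₗ (hS a).some.r.hom, ?_⟩
  rw [comp_diskLift]
  congr 1
  funext a
  ext x
  exact congrArg (s a) (ConcreteCategory.congr_hom (hS a).some.f_r x)

/-- The levelwise split embedding into a contractible `N`-complex. -/
noncomputable def toDisk (X : NComplex (ModuleCat.{u} R) N) : X ⟶ disk N X.deg :=
  diskLift fun _ => LinearMap.id

lemma toDisk_val_self (X : NComplex (ModuleCat.{u} R) N) (i : ℤ) (x : X.deg i) :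
    diskVal i (component X.toDisk i x) i = x := by
  rw [toDisk, diskLift_val, dExt_of_le _ le_rfl, dPow_refl]
  split_ifs with h
  · rfl
  -- The window misses `i` only if `N = 0`, and then `X` vanishes.
  · rw [← X.dPow_refl le_rfl x, dPow_apply_eq_zero _ _ (by omega)]

/-- The levelwise split projection from a contractible `N`-complex. -/
noncomputable def fromDisk (Y : NComplex (ModuleCat.{u} R) N) :
    disk N (fun a => Y.deg (a - N + 1)) ⟶ Y :=
  diskDesc fun _ => LinearMap.id

lemma exists_fromDisk_eq (Y : NComplex (ModuleCat.{u} R) N) (i : ℤ) (y : Y.deg i) :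
    ∃ m, component Y.fromDisk i m = y := by
  obtain ⟨j, rfl⟩ : ∃ j : ℤ, i = j - N + 1 := ⟨i + N - 1, by omega⟩
  by_cases hN : N = 0
  · refine ⟨0, ?_⟩
    rw [map_zero, ← Y.dPow_refl le_rfl y, dPow_apply_eq_zero _ _ (by omega)]
  refine ⟨diskSingle N (fun a => Y.deg (a - N + 1)) j y, ?_⟩
  rw [fromDisk, component_diskDesc, Finset.sum_eq_single j]
  · rw [dExt_of_le _ le_rfl, dPow_refl, diskVal_diskSingle, if_pos (by omega), Pi.single_eq_same]
    rfl
  · intro b _ hb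
    rw [diskVal_diskSingle, Pi.single_eq_of_ne hb, ite_self, map_zero, map_zero]
  · intro h
    exact absurd (Finset.mem_Ico.2 (by omega)) h

end Disk

end NComplex

/-! ### Nullhomotopic morphisms -/

namespace NComplex

section Homotopy

variable {R : Type u} [Ring R] {N : ℕ}

/-! ### Levelwise split sequences and cokernels -/

lemma LevelwiseSplit.exists_linear {S : ShortComplex (NComplex (ModuleCat.{u} R) N)}
    (hS : LevelwiseSplit S) (i : ℤ) :
    ∃ (r : S.X₂.deg i →ₗ[R] S.X₁.deg i) (s : S.X₃.deg i →ₗ[R] S.X₂.deg i),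
      (∀ y, r (component S.f i y) = y) ∧
        ∀ x, component S.f i (r x) + s (component S.g i x) = x :=
  ⟨(hS i).some.r.hom, (hS i).some.s.hom,
    fun y => ConcreteCategory.congr_hom (hS i).some.f_r y,
    fun x => ConcreteCategory.congr_hom (hS i).some.id x⟩

lemma LevelwiseSplit.exists_lift {S : ShortComplex (NComplex (ModuleCat.{u} R) N)}
    (hS : LevelwiseSplit S) {X : NComplex (ModuleCat.{u} R) N} (w : X ⟶ S.X₂)
    (hw : w ≫ S.g = 0) : ∃ u : X ⟶ S.X₁, u ≫ S.f = w := by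
  choose r s hr hs using hS.exists_linear
  have hf : ∀ i (x : X.deg i), component S.f i (r i (component w i x)) = component w i x :=
    fun i x => by
      have h₁ := hs i (component w i x)
      rwa [← component_comp w, hw, component_zero, map_zero, add_zero] at h₁
  refine ⟨homOfLinear (fun i => r i ∘ₗ (component w i).hom) fun i j h x => ?_,
    hom_ext_elements fun i x => hf i x⟩
  -- The retractions `r` are not compatible with `d`, but their composite with `w` is, as one sees
  -- after applying the injective map `S.f`.
  have h₁ : component S.f j (r j (component w j (X.dPow i j h x))) =
      component S.f j (S.X₁.dPow i j h (r i (component w i x))) := by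
    rw [hf, component_dPow, component_dPow, hf]
  have h₂ := congrArg (r j) h₁
  rw [hr, hr] at h₂
  exact h₂

/-- The degreewise cokernel of a morphism of `N`-complexes of modules. -/
noncomputable def coker {A B : NComplex (ModuleCat.{u} R) N} (j : A ⟶ B) :
    NComplex (ModuleCat.{u} R) N :=
  ofModules (fun i => ModuleCat.of R (B.deg i ⧸ LinearMap.range (component j i).hom))
    (fun a b h => Submodule.mapQ _ _ (B.dPow a b h).hom (by
      rintro _ ⟨x, rfl⟩
      exact ⟨A.dPow a b h x, component_dPow j h x⟩))
    (fun i x => by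
      obtain ⟨x, rfl⟩ := Submodule.mkQ_surjective _ x
      exact congrArg _ (dPow_refl B le_rfl x))
    (fun i j k h h' x => by
      obtain ⟨x, rfl⟩ := Submodule.mkQ_surjective _ x
      exact congrArg _ (dPow_dPow B h h' x))
    (fun i h x => by
      obtain ⟨x, rfl⟩ := Submodule.mkQ_surjective _ x
      exact (congrArg _ (dPow_apply_eq_zero B h le_rfl x)).trans (map_zero (Submodule.mkQ _)))

/-- The projection to the cokernel. -/
noncomputable def cokerπ {A B : NComplex (ModuleCat.{u} R) N} (j : A ⟶ B) : B ⟶ coker j :=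
  homOfLinear (fun _ => Submodule.mkQ _) (fun _ _ _ _ => rfl)

lemma cokerπ_surjective {A B : NComplex (ModuleCat.{u} R) N} (j : A ⟶ B) (i : ℤ) :
    Function.Surjective (component (cokerπ j) i) :=
  Submodule.mkQ_surjective _

lemma cokerπ_eq_zero_iff {A B : NComplex (ModuleCat.{u} R) N} (j : A ⟶ B) (i : ℤ)
    (b : B.deg i) : component (cokerπ j) i b = 0 ↔ ∃ a, component j i a = b :=
  (Submodule.Quotient.mk_eq_zero _).trans LinearMap.mem_range

lemma comp_cokerπ {A B : NComplex (ModuleCat.{u} R) N} (j : A ⟶ B) : j ≫ cokerπ j = 0 :=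
  hom_ext_elements fun i x => (cokerπ_eq_zero_iff j i _).2 ⟨x, rfl⟩

lemma levelwiseSplit_coker {A B : NComplex (ModuleCat.{u} R) N} (j : A ⟶ B)
    (r : ∀ i, B.deg i →ₗ[R] A.deg i) (hr : ∀ i x, r i (component j i x) = x) :
    LevelwiseSplit (ShortComplex.mk j (cokerπ j) (comp_cokerπ j)) := by
  intro i
  refine ⟨ShortComplex.Splitting.ofExactOfRetraction _ ?_ (ModuleCat.ofHom (r i)) ?_ ?_⟩
  · rw [ShortComplex.moduleCat_exact_iff]
    exact fun b hb => (cokerπ_eq_zero_iff j i b).1 hb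
  · ext x
    exact hr i x
  · exact (ModuleCat.epi_iff_surjective _).2 (cokerπ_surjective j i)

/-- A direct chase in place of a long exact sequence: injectivity on cohomology corrects a
representative to a cocycle of `B`, and surjectivity makes that cocycle a boundary modulo `A`. -/
lemma acyclic_coker {A B : NComplex (ModuleCat.{u} R) N} (j : A ⟶ B)
    (hinj : ∀ i, Function.Injective (component j i)) (hj : quasiIso (ModuleCat.{u} R) N j) :
    (coker j).Acyclic := by
  rw [quasiIso_iff] at hj
  rw [acyclic_iff]
  intro a b c h h' hc x hx
  obtain ⟨x, rfl⟩ := cokerπ_surjective j b x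
  rw [← component_dPow, cokerπ_eq_zero_iff] at hx
  obtain ⟨y, hy⟩ := hx
  have hy' : A.dPow c (b + N) (by omega) y = 0 := hinj _ (by
    rw [component_dPow, hy, dPow_dPow, dPow_apply_eq_zero _ _ le_rfl, map_zero])
  obtain ⟨y', hy'⟩ := (hj b c (b + N) h' (by omega) rfl).1 y hy' x hy.symm
  obtain ⟨w, -, z, hz⟩ := (hj a b c h h' hc).2 (x - component j b y')
    (by rw [map_sub, ← component_dPow, hy', hy, sub_self])
  refine ⟨component (cokerπ j) a z, ?_⟩
  rw [← component_dPow, ← sub_eq_zero, ← map_sub, cokerπ_eq_zero_iff]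
  exact ⟨-(y' + w), by rw [map_neg, map_add, eq_sub_of_add_eq' hz]; abel⟩

/-- Since `toDisk` is a levelwise split monomorphism, every split injective object is a retract of a
disk. -/
lemma exists_section_toDisk (P : NComplex (ModuleCat.{u} R) N) (hP : SplitInjective P) :
    ∃ g : disk N P.deg ⟶ P, P.toDisk ≫ g = 𝟙 P :=
  hP _ (levelwiseSplit_coker P.toDisk (fun i => LinearMap.proj i ∘ₗ diskVal i)
    (fun i x => P.toDisk_val_self i x)) (𝟙 P)

lemma FactorsThroughProjInj.exists_eq {X Y : NComplex (ModuleCat.{u} R) N} {f : X ⟶ Y}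
    (hf : FactorsThroughProjInj f) :
    ∃ s : ∀ a : ℤ, X.deg a →ₗ[R] Y.deg (a - N + 1), f = diskLift s ≫ Y.fromDisk := by
  obtain ⟨P, -, hP, a, b, rfl⟩ := hf
  obtain ⟨g, hg⟩ := exists_section_toDisk P hP
  obtain ⟨s, hs⟩ := exists_eq_diskLift (a ≫ P.toDisk)
  obtain ⟨t, ht⟩ := exists_eq_diskDesc (g ≫ b)
  -- A composite through a disk depends only on the graded map `t ∘ s`, so the disk may be replaced
  -- by the one that covers `Y`.
  refine ⟨fun a => t a ∘ₗ s a, ?_⟩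
  have h : a ≫ b = diskLift s ≫ diskDesc t := by
    rw [← hs, ← ht, Category.assoc, reassoc_of% hg]
  rw [h]
  refine hom_ext_elements fun i x => ?_
  rw [fromDisk, component_diskLift_comp_diskDesc, component_diskLift_comp_diskDesc]
  rfl

lemma factorsThroughProjInj_iff {X Y : NComplex (ModuleCat.{u} R) N} (f : X ⟶ Y) :
    FactorsThroughProjInj f ↔
      ∃ s : ∀ a : ℤ, X.deg a →ₗ[R] Y.deg (a - N + 1), f = diskLift s ≫ Y.fromDisk :=
  ⟨fun h => h.exists_eq, fun ⟨s, hs⟩ => ⟨_, splitProjective_disk N _, splitInjective_disk N _,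
    diskLift s, Y.fromDisk, hs.symm⟩⟩

lemma component_diskLift_comp_fromDisk {X Y : NComplex (ModuleCat.{u} R) N}
    (s : ∀ a : ℤ, X.deg a →ₗ[R] Y.deg (a - N + 1)) (i : ℤ) (x : X.deg i) :
    component (diskLift s ≫ Y.fromDisk) i x =
      ∑ j : Fin N, Y.dPow (i + (j : ℕ) - N + 1) i (by omega)
        (s (i + (j : ℕ)) (X.dPow i (i + (j : ℕ)) (by omega) x)) := by
  rw [fromDisk, component_diskLift_comp_diskDesc]
  symm
  -- The substitution `a = i + j` turns the sum over the window into the nullhomotopy formula.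
  refine Finset.sum_bij (fun (j : Fin N) _ => i + (j : ℕ)) ?_ ?_ ?_ ?_
  · intro j _
    rw [Finset.mem_Ico]
    omega
  · intro j _ j' _ h
    ext
    omega
  · intro b hb
    rw [Finset.mem_Ico] at hb
    exact ⟨⟨(b - i).toNat, by omega⟩, Finset.mem_univ _, by simp only; omega⟩
  · intro j _
    rw [dExt_of_le _ (by omega), dExt_of_le _ (by omega)]
    rfl

lemma nullhomotopic_iff {X Y : NComplex (ModuleCat.{u} R) N} (f : X ⟶ Y) :
    Nullhomotopic f ↔ FactorsThroughProjInj f := by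
  rw [factorsThroughProjInj_iff]
  have key : ∀ (s : ∀ j : ℤ, X.deg j ⟶ Y.deg (j - N + 1)) (i : ℤ) (x : X.deg i),
      (∑ j : Fin N, X.dPow i (i + (j : ℕ)) (by omega) ≫ s (i + (j : ℕ)) ≫
        Y.dPow (i + (j : ℕ) - N + 1) i (by omega)) x =
        component (diskLift (fun a => (s a).hom) ≫ Y.fromDisk) i x := fun s i x => by
    rw [component_diskLift_comp_fromDisk]
    change ModuleCat.Hom.hom _ x = _
    rw [ModuleCat.hom_sum, LinearMap.sum_apply]
    rfl
  refine ⟨fun ⟨s, hs⟩ => ⟨fun a => (s a).hom, hom_ext_elements fun i x => ?_⟩,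
    fun ⟨s, hs⟩ => ⟨fun a => ModuleCat.ofHom (s a), fun i => ?_⟩⟩
  · rw [hs, key]
  · ext x
    exact (ConcreteCategory.congr_hom (congrArg (fun f => component f i) hs) x).trans
      (key (fun a => ModuleCat.ofHom (s a)) i x).symm

lemma proj_map_eq_iff {X Y : NComplex (ModuleCat.{u} R) N} (f g : X ⟶ Y) :
    (KN.proj (ModuleCat.{u} R) N).map f = (KN.proj (ModuleCat.{u} R) N).map g ↔
      FactorsThroughProjInj (f - g) :=
  CategoryTheory.Quotient.functor_map_eq_iff (stableRel (ModuleCat.{u} R) N) f g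

lemma proj_map_eq_zero_iff {X Y : NComplex (ModuleCat.{u} R) N} (f : X ⟶ Y) :
    (KN.proj (ModuleCat.{u} R) N).map f = 0 ↔ FactorsThroughProjInj f := by
  rw [← (KN.proj (ModuleCat.{u} R) N).map_zero, proj_map_eq_iff, sub_zero]

/-! ### Quasi-isomorphisms -/

instance : (quasiIso (ModuleCat.{u} R) N).HasTwoOutOfThreeProperty where
  comp_mem f g hf hg i r hr hr' := by
    rw [Functor.map_comp]
    have := hf i r hr hr'
    have := hg i r hr hr'
    infer_instance
  of_postcomp f g hg hfg i r hr hr' := by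
    have := hg i r hr hr'
    have := hfg i r hr hr'
    rw [Functor.map_comp] at this
    exact IsIso.of_isIso_comp_right _ ((cohomology (ModuleCat.{u} R) N r hr'.le i).map g)
  of_precomp f g hf hfg i r hr hr' := by
    have := hf i r hr hr'
    have := hfg i r hr hr'
    rw [Functor.map_comp] at this
    exact IsIso.of_isIso_comp_left ((cohomology (ModuleCat.{u} R) N r hr'.le i).map f) _

lemma quasiIso_id (X : NComplex (ModuleCat.{u} R) N) : quasiIso (ModuleCat.{u} R) N (𝟙 X) :=
  fun i r hr hr' => by
    rw [CategoryTheory.Functor.map_id]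
    infer_instance

lemma biprod_total {X Y : NComplex (ModuleCat.{u} R) N} (i : ℤ) (x : (X ⊞ Y).deg i) :
    component (biprod.inl : X ⟶ X ⊞ Y) i (component (biprod.fst : X ⊞ Y ⟶ X) i x) +
      component (biprod.inr : Y ⟶ X ⊞ Y) i (component (biprod.snd : X ⊞ Y ⟶ Y) i x) = x :=
  ConcreteCategory.congr_hom
    (congrArg (fun f => component f i) (biprod.total (X := X) (Y := Y))) x

lemma biprod_inl_fst {X Y : NComplex (ModuleCat.{u} R) N} (i : ℤ) (x : X.deg i) :
    component (biprod.fst : X ⊞ Y ⟶ X) i (component (biprod.inl : X ⟶ X ⊞ Y) i x) = x :=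
  ConcreteCategory.congr_hom
    (congrArg (fun f => component f i) (biprod.inl_fst (X := X) (Y := Y))) x

lemma biprod_inr_fst {X Y : NComplex (ModuleCat.{u} R) N} (i : ℤ) (y : Y.deg i) :
    component (biprod.fst : X ⊞ Y ⟶ X) i (component (biprod.inr : Y ⟶ X ⊞ Y) i y) = 0 :=
  ConcreteCategory.congr_hom
    (congrArg (fun f => component f i) (biprod.inr_fst (X := X) (Y := Y))) y

lemma quasiIso_biprod_fst (X Y : NComplex (ModuleCat.{u} R) N) (hY : Y.Acyclic) :
    quasiIso (ModuleCat.{u} R) N (biprod.fst : X ⊞ Y ⟶ X) := by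
  refine (quasiIso_iff_of_surjective _ fun i x => ⟨component (biprod.inl : X ⟶ X ⊞ Y) i x,
    biprod_inl_fst i x⟩).2 ?_
  intro a b c h h' hc x y hx hy
  obtain ⟨z, hz⟩ := (acyclic_iff Y).1 hY a b c h h' hc (component (biprod.snd : X ⊞ Y ⟶ Y) b x)
    (by rw [← component_dPow, hx, map_zero])
  refine ⟨component (biprod.inl : X ⟶ X ⊞ Y) a y + component (biprod.inr : Y ⟶ X ⊞ Y) a z, ?_, ?_⟩
  · rw [map_add, biprod_inl_fst, biprod_inr_fst, add_zero]
  · rw [map_add, ← component_dPow, ← component_dPow, hy, hz, biprod_total]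

lemma quasiIso_biprod_inl (X Y : NComplex (ModuleCat.{u} R) N) (hY : Y.Acyclic) :
    quasiIso (ModuleCat.{u} R) N (biprod.inl : X ⟶ X ⊞ Y) :=
  (quasiIso (ModuleCat.{u} R) N).of_postcomp _ _ (quasiIso_biprod_fst X Y hY) (by
    rw [biprod.inl_fst]
    exact quasiIso_id X)

/-- The cokernel of the levelwise split monomorphism `(σ, toDisk) : Y → Z ⊞ disk` plays the role of
the cone of `σ`. It is acyclic, so `h` becomes stably zero in it; after subtraction of a map through
a projective-injective object, `h` lands in `Y`. -/
lemma hProj.exists_lift {X Y Z : NComplex (ModuleCat.{u} R) N}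
    (hX : hProj (ModuleCat.{u} R) N ((KN.proj (ModuleCat.{u} R) N).obj X)) (σ : Y ⟶ Z)
    (hσ : quasiIso (ModuleCat.{u} R) N σ) (h : X ⟶ Z) :
    ∃ u : X ⟶ Y, (KN.proj (ModuleCat.{u} R) N).map (u ≫ σ) =
      (KN.proj (ModuleCat.{u} R) N).map h := by
  let j : Y ⟶ Z ⊞ disk N Y.deg := biprod.lift σ Y.toDisk
  have hj : quasiIso (ModuleCat.{u} R) N j :=
    (quasiIso (ModuleCat.{u} R) N).of_postcomp _ _
      (quasiIso_biprod_fst Z (disk N Y.deg) (acyclic_disk N _)) (by rwa [biprod.lift_fst])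
  have hr : ∀ i (y : Y.deg i),
      (LinearMap.proj i ∘ₗ diskVal i ∘ₗ
        (component (biprod.snd : Z ⊞ disk N Y.deg ⟶ _) i).hom) (component j i y) = y :=
      fun i y => by
    have h₁ : component (biprod.snd : Z ⊞ disk N Y.deg ⟶ _) i (component j i y) =
        component Y.toDisk i y := by
      rw [← component_comp, biprod.lift_snd]
    exact (congrArg (fun m => diskVal i m i) h₁).trans (Y.toDisk_val_self i y)
  have hS := levelwiseSplit_coker j _ hr
  have hC : (coker j).Acyclic := acyclic_coker j (fun i => Function.LeftInverse.injective (hr i)) hj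
  have := hX (coker j) hC
  have h0 : (KN.proj (ModuleCat.{u} R) N).map (h ≫ biprod.inl ≫ cokerπ j) = 0 :=
    Subsingleton.elim _ _
  rw [proj_map_eq_zero_iff] at h0
  obtain ⟨P, hP, hP', α, β, hαβ⟩ := h0
  -- Split projectivity of `P` lifts the null map from the cokernel to `Z ⊞ disk`.
  obtain ⟨β', hβ'⟩ := hP _ hS β
  obtain ⟨u, hu⟩ := hS.exists_lift (h ≫ biprod.inl - α ≫ β') (by
    rw [Preadditive.sub_comp, Category.assoc, Category.assoc, hβ', hαβ, sub_self])
  refine ⟨u, (proj_map_eq_iff _ _).2 ⟨P, hP, hP', α, -(β' ≫ biprod.fst), ?_⟩⟩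
  have h₁ := congrArg (fun f => f ≫ biprod.fst) hu
  simp only [j, Category.assoc, biprod.lift_fst, Preadditive.sub_comp, biprod.inl_fst,
    Category.comp_id] at h₁
  rw [h₁, Preadditive.comp_neg]
  abel

/-- `f` factors as `(1, s)` into `X ⊞ disk` followed by `(g, fromDisk)`. Both factors are
quasi-isomorphisms, because the acyclic summand is invisible to cohomology. -/
lemma quasiIso_of_proj_map_eq {X Y : NComplex (ModuleCat.{u} R) N} {f g : X ⟶ Y}
    (h : (KN.proj (ModuleCat.{u} R) N).map f = (KN.proj (ModuleCat.{u} R) N).map g)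
    (hg : quasiIso (ModuleCat.{u} R) N g) : quasiIso (ModuleCat.{u} R) N f := by
  rw [proj_map_eq_iff, factorsThroughProjInj_iff] at h
  obtain ⟨s, hs⟩ := h
  have : f = biprod.lift (𝟙 X) (diskLift s) ≫ biprod.desc g Y.fromDisk := by
    rw [biprod.lift_desc, Category.id_comp, ← hs]
    abel
  rw [this]
  refine (quasiIso (ModuleCat.{u} R) N).comp_mem _ _ ?_ ?_
  · refine (quasiIso (ModuleCat.{u} R) N).of_postcomp _ _
      (quasiIso_biprod_fst X _ (acyclic_disk N _)) ?_
    rw [biprod.lift_fst]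
    exact quasiIso_id X
  · refine (quasiIso (ModuleCat.{u} R) N).of_precomp _ _
      (quasiIso_biprod_inl X _ (acyclic_disk N _)) ?_
    rwa [biprod.inl_desc]

/-- A right inverse `q` of `p` in `K_N` is again a quasi-isomorphism, so it has a right inverse `w`
too, and then `w = p` in `K_N`. -/
lemma hProj.isIso_proj_map {X Y : NComplex (ModuleCat.{u} R) N}
    (hX : hProj (ModuleCat.{u} R) N ((KN.proj (ModuleCat.{u} R) N).obj X))
    (hY : hProj (ModuleCat.{u} R) N ((KN.proj (ModuleCat.{u} R) N).obj Y)) (p : X ⟶ Y)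
    (hp : quasiIso (ModuleCat.{u} R) N p) : IsIso ((KN.proj (ModuleCat.{u} R) N).map p) := by
  obtain ⟨q, hq⟩ := hProj.exists_lift hY p hp (𝟙 Y)
  have hq' : quasiIso (ModuleCat.{u} R) N q :=
    (quasiIso (ModuleCat.{u} R) N).of_postcomp _ _ hp (quasiIso_of_proj_map_eq hq (quasiIso_id Y))
  obtain ⟨w, hw⟩ := hProj.exists_lift hX q hq' (𝟙 X)
  rw [Functor.map_comp, CategoryTheory.Functor.map_id] at hq hw
  have hwp : (KN.proj (ModuleCat.{u} R) N).map w = (KN.proj (ModuleCat.{u} R) N).map p := by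
    rw [← Category.comp_id ((KN.proj (ModuleCat.{u} R) N).map w), ← hq, reassoc_of% hw]
  exact ⟨(KN.proj (ModuleCat.{u} R) N).map q, by rw [← hwp, hw], hq⟩

end Homotopy

end NComplex

/-! ### Morphisms from `μ_k^i(R)` -/

namespace NComplex

section Mu

variable {R : Type u} [Ring R] {N : ℕ}

/-- In the degrees in which `μ_k^i(R)` is nonzero, it is `R`. -/
noncomputable def muEquiv {k : ℕ} (hk : k ≤ N) {i j : ℤ} (h : i - k < j ∧ j ≤ i) :
    R ≃ₗ[R] (mu N (ModuleCat.of R R) k hk i).deg j :=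
  (eqToIso (muObj_eq (ModuleCat.of R R) h).symm).toLinearEquiv

/-- The scalars as elements of `μ_k^i(R)` in degree `j`; they vanish in the degrees in which
`μ_k^i(R)` is zero. -/
noncomputable def muScalar (k : ℕ) (hk : k ≤ N) (i j : ℤ) :
    R →ₗ[R] (mu N (ModuleCat.of R R) k hk i).deg j :=
  if h : i - k < j ∧ j ≤ i then (muEquiv hk h).toLinearMap else 0

lemma muScalar_eq {k : ℕ} (hk : k ≤ N) {i j : ℤ} (h : i - k < j ∧ j ≤ i) (t : R) :
    muScalar k hk i j t = muEquiv hk h t := by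
  rw [muScalar, dif_pos h]
  rfl

lemma mu_eq_zero {k : ℕ} (hk : k ≤ N) {i j : ℤ} (h : ¬ (i - k < j ∧ j ≤ i))
    (x : (mu N (ModuleCat.of R R) k hk i).deg j) : x = 0 :=
  ConcreteCategory.congr_hom
    ((isZero_muObj (ModuleCat.of R R) h).eq_of_src (𝟙 _) 0) x

/-- Stated for any `f` equal to `muHom`, to cover both the differentials (`k = l`) and the
components of `muι` (`a = b`). -/
lemma muHom_muScalar {k l : ℕ} (hk : k ≤ N) (hl : l ≤ N) {i a b : ℤ}
    (ha : i - k < a ∧ a ≤ i) (hb : i - l < b)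
    (f : (mu N (ModuleCat.of R R) k hk i).deg a ⟶ (mu N (ModuleCat.of R R) l hl i).deg b)
    (hf : f = muHom (ModuleCat.of R R) k l i a b) (t : R) :
    f (muScalar k hk i a t) = muScalar l hl i b t := by
  by_cases hb' : b ≤ i
  · rw [muScalar_eq hk ha, muScalar_eq hl ⟨hb, hb'⟩, hf, muHom, dif_pos ⟨ha, hb, hb'⟩]
    exact ConcreteCategory.congr_hom (eqToHom_trans (muObj_eq (ModuleCat.of R R) ha).symm
      ((muObj_eq (ModuleCat.of R R) ha).trans
        (muObj_eq (ModuleCat.of R R) (k := l) ⟨hb, hb'⟩).symm)) t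
  · rw [mu_eq_zero hl (by omega) (f _), mu_eq_zero hl (by omega) (muScalar l hl i b t)]

lemma muScalar_surjective {k : ℕ} (hk : k ≤ N) {i j : ℤ} (h : i - k < j ∧ j ≤ i)
    (x : (mu N (ModuleCat.of R R) k hk i).deg j) : ∃ t, muScalar k hk i j t = x :=
  ⟨(muEquiv hk h).symm x, by rw [muScalar_eq hk h, LinearEquiv.apply_symm_apply]⟩

lemma dPow_muScalar {k : ℕ} (hk : k ≤ N) {i a b : ℤ} (h : a ≤ b) (ha : i - k < a) (t : R) :
    (mu N (ModuleCat.of R R) k hk i).dPow a b h (muScalar k hk i a t) = muScalar k hk i b t := by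
  by_cases ha' : a ≤ i
  · exact muHom_muScalar hk hk ⟨ha, ha'⟩ (by omega) _ rfl t
  · rw [mu_eq_zero hk (by omega) (muScalar k hk i a t), map_zero]
    exact (mu_eq_zero hk (by omega) _).symm

lemma muι_muScalar {r : ℕ} (hr : r ≤ N) {i a : ℤ} (ha : i - r < a) (t : R) :
    component (muι N (ModuleCat.of R R) r hr i) a (muScalar r hr i a t) =
      muScalar N le_rfl i a t := by
  by_cases ha' : a ≤ i
  · exact muHom_muScalar hr le_rfl ⟨ha, ha'⟩ (by omega) _ rfl t
  · rw [mu_eq_zero hr (by omega) (muScalar r hr i a t), map_zero]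
    exact (mu_eq_zero le_rfl (by omega) _).symm

/-- The lowest degree generates `μ_k^i(R)`. It is a variable `b` with an equation, so that it can be
matched to a given degree without casts. -/
lemma mu_hom_ext {k : ℕ} {hk : k ≤ N} {i : ℤ} {X : NComplex (ModuleCat.{u} R) N}
    {f g : mu N (ModuleCat.of R R) k hk i ⟶ X} {b : ℤ} (hb : b = i - k + 1)
    (h : component f b (muScalar k hk i b 1) = component g b (muScalar k hk i b 1)) : f = g := by
  refine hom_ext_elements fun j x => ?_
  by_cases hj : i - k < j ∧ j ≤ i
  · obtain ⟨t, rfl⟩ := muScalar_surjective hk hj x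
    have : muScalar k hk i j t = t • (mu N (ModuleCat.of R R) k hk i).dPow b j (by omega)
        (muScalar k hk i b 1) := by
      rw [dPow_muScalar hk _ (by omega), ← map_smul, smul_eq_mul, mul_one]
    rw [this, map_smul, map_smul, component_dPow, component_dPow, h]
  · rw [mu_eq_zero hk hj x, map_zero, map_zero]

/-- The components of the morphism from `μ_k^i(R)` determined by the image of the generator. -/
noncomputable def muDescApp {k : ℕ} (hk : k ≤ N) (i : ℤ) {X : NComplex (ModuleCat.{u} R) N} {b : ℤ}
    (x : X.deg b) (j : ℤ) : (mu N (ModuleCat.of R R) k hk i).deg j →ₗ[R] X.deg j :=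
  if h : i - k < j ∧ j ≤ i then
    LinearMap.toSpanSingleton R _ (X.dExt b j x) ∘ₗ (muEquiv hk h).symm.toLinearMap else 0

lemma muDescApp_muScalar {k : ℕ} (hk : k ≤ N) {i : ℤ} {X : NComplex (ModuleCat.{u} R) N} {b : ℤ}
    (hb : b = i - k + 1) (x : X.deg b) (hx : X.dExt b (i + 1) x = 0) {j : ℤ} (hj : b ≤ j) (t : R) :
    muDescApp hk i x j (muScalar k hk i j t) = t • X.dExt b j x := by
  by_cases hj' : j ≤ i
  · have h : i - k < j ∧ j ≤ i := by omega
    rw [muDescApp, dif_pos h, muScalar_eq hk h, LinearMap.comp_apply, LinearEquiv.coe_coe,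
      LinearEquiv.symm_apply_apply, LinearMap.toSpanSingleton_apply]
  · rw [dExt_of_le _ (by omega : b ≤ i + 1)] at hx
    rw [muDescApp, dif_neg (by omega), LinearMap.zero_apply, dExt_of_le _ hj,
      ← dPow_dPow X (by omega : b ≤ i + 1) (by omega) x, hx, map_zero, smul_zero]

/-- The morphism from `μ_k^i(R)` determined by the image of the generator. -/
noncomputable def muDesc {k : ℕ} (hk : k ≤ N) {i : ℤ} {X : NComplex (ModuleCat.{u} R) N} {b : ℤ}
    (hb : b = i - k + 1) (x : X.deg b) (hx : X.dExt b (i + 1) x = 0) :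
    mu N (ModuleCat.of R R) k hk i ⟶ X :=
  homOfLinear (muDescApp hk i x) (by
    intro a c h y
    by_cases ha : i - k < a ∧ a ≤ i
    · obtain ⟨t, rfl⟩ := muScalar_surjective hk ha y
      rw [dPow_muScalar hk h ha.1, muDescApp_muScalar hk hb x hx (by omega),
        muDescApp_muScalar hk hb x hx (by omega), map_smul,
        dExt_of_le _ (by omega : b ≤ a), dExt_of_le _ (by omega : b ≤ c), dPow_dPow]
    · rw [mu_eq_zero hk ha y]
      simp only [map_zero])

lemma component_muDesc {k : ℕ} (hk : k ≤ N) {i : ℤ} {X : NComplex (ModuleCat.{u} R) N} {b : ℤ}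
    (hb : b = i - k + 1) (x : X.deg b) (hx : X.dExt b (i + 1) x = 0) :
    component (muDesc hk hb x hx) b (muScalar k hk i b 1) = x := by
  rw [muDesc, homOfLinear_apply, muDescApp_muScalar hk hb x hx le_rfl, one_smul,
    dExt_of_le _ le_rfl, dPow_refl]

lemma dExt_component_mu {k : ℕ} {hk : k ≤ N} {i : ℤ} {X : NComplex (ModuleCat.{u} R) N}
    (f : mu N (ModuleCat.of R R) k hk i ⟶ X) {b c : ℤ} (hc : i < c)
    (x : (mu N (ModuleCat.of R R) k hk i).deg b) : X.dExt b c (component f b x) = 0 := by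
  rw [← component_dExt, mu_eq_zero hk (by omega) (dExt _ _ _ _), map_zero]

/-! ### Lifting properties -/

lemma rlp_generatingTrivialCofibrations_iff {X Y : NComplex (ModuleCat.{u} R) N} (f : X ⟶ Y) :
    (generatingTrivialCofibrations R N).rlp f ↔ ∀ i, Function.Surjective (component f i) := by
  refine ⟨fun h a y => ?_, fun h A B g hg => ?_⟩
  · have := h _ (MorphismProperty.ofHoms.mk (a + N - 1))
    let v := muDesc (i := a + N - 1) (b := a) le_rfl (by omega) y (dExt_eq_zero _ (by omega) _)
    have sq : CommSq (0 : (0 : NComplex (ModuleCat.{u} R) N) ⟶ X) 0 f v :=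
      ⟨(isZero_zero _).eq_of_src _ _⟩
    refine ⟨component sq.lift a (muScalar N le_rfl (a + N - 1) a 1), ?_⟩
    rw [← component_comp, sq.fac_right]
    exact component_muDesc _ _ _ _
  · obtain ⟨i⟩ := hg
    refine ⟨fun {w v} sq => ?_⟩
    obtain ⟨x, hx⟩ := h (i - N + 1) (component v _ (muScalar N le_rfl i (i - N + 1) 1))
    refine ⟨⟨muDesc le_rfl rfl x (dExt_eq_zero _ (by omega) _),
      (isZero_zero _).eq_of_src _ _, mu_hom_ext rfl ?_⟩⟩
    rw [component_comp, component_muDesc, hx]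

/-- A square from `μ_r^i → μ_N^i` to `f` is a pair `x`, `y` with `d^r x = 0` and `d^(N-r) y = f x`;
a lift is an `x'` over `y` with `d^(N-r) x' = x`. This is the criterion `quasiIso_iff_of_surjective`
for the degrees `i - N + 1 < i - r + 1 < i + 1`. -/
lemma rlp_generatingCofibrations_iff {X Y : NComplex (ModuleCat.{u} R) N} (f : X ⟶ Y) :
    (generatingCofibrations R N).rlp f ↔
      (generatingTrivialCofibrations R N).rlp f ∧ quasiIso (ModuleCat.{u} R) N f := by
  have hsup : (generatingCofibrations R N).rlp f ↔ (generatingTrivialCofibrations R N).rlp f ∧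
      ∀ (i : ℤ) (r : ℕ) (h : 0 < r ∧ r < N),
        HasLiftingProperty (muι N (ModuleCat.of R R) r h.2.le i) f :=
    ⟨fun h => ⟨fun _ _ g hg => h g (Or.inl hg),
      fun i r hr => h _ (Or.inr (MorphismProperty.ofHoms.mk
        (f := fun p : ℤ × { r : ℕ // 0 < r ∧ r < N } =>
          muι N (ModuleCat.of R R) p.2.1 p.2.2.2.le p.1) (i, ⟨r, hr⟩)))⟩,
    fun h => by
      rintro _ _ g (hg | ⟨i, r, hr⟩)
      · exact h.1 g hg
      · exact h.2 i r hr⟩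
  rw [hsup]
  refine and_congr_right fun hf => ?_
  rw [quasiIso_iff_of_surjective f ((rlp_generatingTrivialCofibrations_iff f).1 hf)]
  refine ⟨fun H a b c h h' hc x y hx hy => ?_, fun H i r hr => ⟨fun {w v} sq => ?_⟩⟩
  · obtain ⟨r, rfl⟩ := Int.le.dest h'.le
    have := H (b + r - 1) r (by omega)
    have hx' : X.dExt b (b + r - 1 + 1) x = 0 := by
      rw [dExt_of_le _ (by omega), ← dPow_dPow X h'.le (by omega), hx, map_zero]
    let w := muDesc (i := b + r - 1) (k := r) (b := b) (by omega : r ≤ N) (by omega) x hx'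
    let v := muDesc (i := b + r - 1) (b := a) le_rfl (by omega) y (dExt_eq_zero _ (by omega) _)
    have hw : component w b (muScalar _ _ _ b 1) = x := component_muDesc _ _ _ _
    have hv : component v a (muScalar _ _ _ a 1) = y := component_muDesc _ _ _ _
    have sq : CommSq w (muι N (ModuleCat.of R R) r (by omega) (b + r - 1)) f v := by
      refine ⟨mu_hom_ext (b := b) (by omega) ?_⟩
      rw [component_comp, component_comp, hw, muι_muScalar _ (by omega),
        ← dPow_muScalar _ h.le (by omega), component_dPow, hv, hy]
    refine ⟨component sq.lift a (muScalar _ _ _ a 1), ?_, ?_⟩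
    · rw [← component_comp, sq.fac_right, hv]
    · rw [← component_dPow, dPow_muScalar _ _ (by omega),
        ← muι_muScalar (r := r) (by omega) (by omega),
        ← component_comp, sq.fac_left, hw]
  · obtain ⟨x', h₁, h₂⟩ := H (i - N + 1) (i - r + 1) (i + 1) (by omega) (by omega) (by omega)
      (component w _ (muScalar _ _ _ _ 1)) (component v _ (muScalar _ _ _ _ 1))
      (by rw [← dExt_of_le, dExt_component_mu w (by omega)])
      (by
        rw [← component_dPow, dPow_muScalar _ _ (by omega),
          ← muι_muScalar (r := r) (by omega) (by omega), ← component_comp, ← sq.w, component_comp])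
    have hl := component_muDesc (i := i) le_rfl rfl x' (dExt_eq_zero _ (by omega) _)
    refine ⟨⟨muDesc le_rfl rfl x' (dExt_eq_zero _ (by omega) _), mu_hom_ext rfl ?_,
      mu_hom_ext rfl ?_⟩⟩
    · rw [component_comp, muι_muScalar _ (by omega),
        ← dPow_muScalar _ (by omega : i - N + 1 ≤ i - r + 1) (by omega), component_dPow, hl, h₂]
    · rw [component_comp, hl, h₁]

end Mu

end NComplex

/-! ### Limits, colimits and the small object argument -/

namespace NComplex

section Colimits

universe w w'

lemma isClosedUnderLimitsOfShape (C : Type u) [Category.{v} C] [HasZeroMorphisms C] (N : ℕ)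
    (J : Type w) [Category.{w'} J] [HasLimitsOfShape J C] :
    (isNComplex C N).IsClosedUnderLimitsOfShape J where
  limitsOfShape_le := by
    rintro X ⟨p⟩ i
    have hl := isLimitOfPreserves ((evaluation ℤ C).obj (i + N)) p.isLimit
    refine hl.hom_ext fun j => ?_
    have h := p.prop_diag_obj j i
    have hn := (p.π.app j).naturality (homOfLE (by omega : i ≤ i + (N : ℤ)))
    rw [h, comp_zero] at hn
    rw [zero_comp]
    exact hn

lemma isClosedUnderColimitsOfShape (C : Type u) [Category.{v} C] [HasZeroMorphisms C] (N : ℕ)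
    (J : Type w) [Category.{w'} J] [HasColimitsOfShape J C] :
    (isNComplex C N).IsClosedUnderColimitsOfShape J where
  colimitsOfShape_le := by
    rintro X ⟨p⟩ i
    have hl := isColimitOfPreserves ((evaluation ℤ C).obj i) p.isColimit
    refine hl.hom_ext fun j => ?_
    have h := p.prop_diag_obj j i
    have hn := (p.ι.app j).naturality (homOfLE (by omega : i ≤ i + (N : ℤ)))
    rw [h, zero_comp] at hn
    rw [comp_zero]
    exact hn.symm

attribute [local instance] isClosedUnderLimitsOfShape isClosedUnderColimitsOfShape

variable (R : Type u) [Ring R] (N : ℕ)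

lemma hasLimits : HasLimitsOfSize.{u, u} (NComplex (ModuleCat.{u} R) N) where
  has_limits_of_shape _ _ := hasLimitsOfShape_of_closedUnderLimits _ _

lemma hasColimits : HasColimitsOfSize.{u, u} (NComplex (ModuleCat.{u} R) N) where
  has_colimits_of_shape _ _ := hasColimitsOfShape_of_closedUnderColimits _ _

attribute [local instance] hasLimits hasColimits

/-! ### Smallness of the sources of the generating maps -/

variable {R N} {K : Type u} [SmallCategory K] [IsFiltered K]

lemma exists_of_isColimit {F : K ⥤ NComplex (ModuleCat.{u} R) N} {c : Cocone F}
    (hc : IsColimit c) (i : ℤ) (x : c.pt.deg i) :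
    ∃ (k : K) (y : (F.obj k).deg i), component (c.ι.app k) i y = x :=
  Types.jointly_surjective_of_isColimit
    (isColimitOfPreserves (evalDeg (ModuleCat.{u} R) N i ⋙ forget _) hc) x

lemma exists_eq_of_isColimit {F : K ⥤ NComplex (ModuleCat.{u} R) N} {c : Cocone F}
    (hc : IsColimit c) (i : ℤ) {k : K} (x y : (F.obj k).deg i)
    (h : component (c.ι.app k) i x = component (c.ι.app k) i y) :
    ∃ (l : K) (f : k ⟶ l), component (F.map f) i x = component (F.map f) i y :=
  (Types.FilteredColimit.isColimit_eq_iff'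
    (isColimitOfPreserves (evalDeg (ModuleCat.{u} R) N i ⋙ forget _) hc) x y).1 h

lemma preservesColimit_coyoneda_of_elements (A : NComplex (ModuleCat.{u} R) N)
    (F : K ⥤ NComplex (ModuleCat.{u} R) N)
    (hsurj : ∀ (c : Cocone F) (_ : IsColimit c) (f : A ⟶ c.pt),
      ∃ (k : K) (g : A ⟶ F.obj k), g ≫ c.ι.app k = f)
    (hinj : ∀ (c : Cocone F) (_ : IsColimit c) (k : K) (f g : A ⟶ F.obj k),
      f ≫ c.ι.app k = g ≫ c.ι.app k → ∃ (l : K) (e : k ⟶ l), f ≫ F.map e = g ≫ F.map e) :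
    PreservesColimit F (coyoneda.obj (Opposite.op A)) where
  preserves {c} hc := ⟨Types.FilteredColimit.isColimitOf' _ _
    (fun f => by
      obtain ⟨k, g, hg⟩ := hsurj c hc f
      exact ⟨k, g, hg.symm⟩)
    (fun k f g h => hinj c hc k f g h)⟩

lemma preservesColimit_coyoneda_zero (F : K ⥤ NComplex (ModuleCat.{u} R) N) :
    PreservesColimit F (coyoneda.obj (Opposite.op (0 : NComplex (ModuleCat.{u} R) N))) :=
  preservesColimit_coyoneda_of_elements _ _
    (fun _ _ _ => ⟨IsFiltered.nonempty.some, 0, (isZero_zero _).eq_of_src _ _⟩)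
    (fun _ _ k _ _ _ => ⟨k, 𝟙 k, (isZero_zero _).eq_of_src _ _⟩)

lemma preservesColimit_coyoneda_mu (k : ℕ) (hk : k ≤ N) (i : ℤ)
    (F : K ⥤ NComplex (ModuleCat.{u} R) N) :
    PreservesColimit F (coyoneda.obj (Opposite.op (mu N (ModuleCat.of R R) k hk i))) := by
  refine preservesColimit_coyoneda_of_elements _ _ (fun c hc f => ?_) (fun c hc l f g h => ?_)
  · obtain ⟨l, y, hy⟩ := exists_of_isColimit hc (i - k + 1)
      (component f (i - k + 1) (muScalar k hk i (i - k + 1) 1))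
    have hy' : c.pt.dExt (i - k + 1) (i + 1) (component (c.ι.app l) (i - k + 1) y) = 0 := by
      rw [hy, dExt_component_mu f (by omega)]
    -- The relation `d^k y = 0` holds only in the colimit so far; filteredness makes it hold at a
    -- later stage.
    obtain ⟨l', e, he⟩ := exists_eq_of_isColimit hc (i + 1)
      ((F.obj l).dExt (i - k + 1) (i + 1) y) 0
        (((component_dExt _ _ _ _).trans hy').trans (map_zero _).symm)
    rw [component_dExt, map_zero] at he
    refine ⟨l', muDesc hk rfl _ he, mu_hom_ext rfl ?_⟩
    rw [component_comp, component_muDesc, ← component_comp, c.w, hy]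
  · obtain ⟨l', e, he⟩ := exists_eq_of_isColimit hc (i - k + 1)
      (component f (i - k + 1) (muScalar k hk i (i - k + 1) 1))
      (component g (i - k + 1) (muScalar k hk i (i - k + 1) 1)) (by
        rw [← component_comp, ← component_comp, h])
    exact ⟨l', e, mu_hom_ext rfl (by rw [component_comp, component_comp, he])⟩

attribute [local instance] Cardinal.fact_isRegular_aleph0 Cardinal.orderBotAleph0OrdToType

lemma hasSmallObjectArgument_of_le (T : MorphismProperty (NComplex (ModuleCat.{u} R) N))
    [MorphismProperty.IsSmall.{u} T] (hT : T ≤ generatingCofibrations R N) :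
    MorphismProperty.HasSmallObjectArgument.{u} T where
  exists_cardinal := ⟨Cardinal.aleph0, inferInstance, inferInstance,
    { preservesColimit := by
        intro A B X Y i hi f hf
        have : IsFiltered Cardinal.aleph0.{u}.ord.ToType := inferInstance
        rcases hT i hi with ⟨⟨j⟩⟩ | ⟨j, r, hr⟩
        · exact preservesColimit_coyoneda_zero _
        · exact preservesColimit_coyoneda_mu _ _ _ _ }⟩

instance : MorphismProperty.IsSmall.{u} (generatingTrivialCofibrations R N) :=
  MorphismProperty.isSmall_ofHoms _

instance : MorphismProperty.IsSmall.{u} (generatingCofibrations R N) where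
  small_toSet := by
    have h : (generatingCofibrations R N).toSet =
        (generatingTrivialCofibrations R N).toSet ∪
          (MorphismProperty.ofHoms fun p : ℤ × { r : ℕ // 0 < r ∧ r < N } =>
            muι N (ModuleCat.of R R) p.2.1 p.2.2.2.le p.1).toSet := rfl
    rw [h]
    exact small_union.{u} _ _

instance : MorphismProperty.HasSmallObjectArgument.{u} (generatingTrivialCofibrations R N) :=
  hasSmallObjectArgument_of_le _ le_sup_left

instance : MorphismProperty.HasSmallObjectArgument.{u} (generatingCofibrations R N) :=
  hasSmallObjectArgument_of_le _ le_rfl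

end Colimits

/-! ### The model structure -/

section Model

variable (R : Type u) [Ring R] (N : ℕ)

lemma rlp_generatingCofibrations_eq : (generatingCofibrations R N).rlp =
    (generatingTrivialCofibrations R N).rlp ⊓ quasiIso (ModuleCat.{u} R) N := by
  ext X Y f
  exact rlp_generatingCofibrations_iff f

variable {R N}

/-- Adding a disk to `A` turns `i` into a surjection `A ⊞ disk → B`, against which `i` lifts. The
lift is a section of this surjection and restricts along `i` to `inl`, a quasi-isomorphism. -/
lemma quasiIso_of_llp_rlp {A B : NComplex (ModuleCat.{u} R) N} (i : A ⟶ B)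
    (hi : (generatingTrivialCofibrations R N).rlp.llp i) : quasiIso (ModuleCat.{u} R) N i := by
  have := hi (biprod.desc i B.fromDisk)
    ((rlp_generatingTrivialCofibrations_iff _).2 fun j b => by
      obtain ⟨m, rfl⟩ := B.exists_fromDisk_eq j b
      exact ⟨component (biprod.inr : _ ⟶ A ⊞ _) j m, by rw [← component_comp, biprod.inr_desc]⟩)
  have sq : CommSq biprod.inl i (biprod.desc i B.fromDisk) (𝟙 B) := ⟨by simp⟩
  intro j r hr hr'
  have h₁ := quasiIso_biprod_inl A _ (acyclic_disk N fun a => B.deg (a - N + 1)) j r hr hr'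
  rw [← sq.fac_left, Functor.map_comp] at h₁
  have h₂ : (cohomology (ModuleCat.{u} R) N r hr'.le j).map sq.lift ≫
      (cohomology (ModuleCat.{u} R) N r hr'.le j).map (biprod.desc i B.fromDisk) = 𝟙 _ := by
    rw [← Functor.map_comp, sq.fac_right, CategoryTheory.Functor.map_id]
  -- On cohomology the lift is split mono, and epi because its composite with `i` is an isomorphism.
  have : Mono ((cohomology (ModuleCat.{u} R) N r hr'.le j).map sq.lift) := mono_of_mono_fac h₂
  have : Epi ((cohomology (ModuleCat.{u} R) N r hr'.le j).map sq.lift) :=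
    epi_of_epi ((cohomology (ModuleCat.{u} R) N r hr'.le j).map i) _
  have : IsIso ((cohomology (ModuleCat.{u} R) N r hr'.le j).map sq.lift) := isIso_of_mono_of_epi _
  exact IsIso.of_isIso_comp_right _ ((cohomology (ModuleCat.{u} R) N r hr'.le j).map sq.lift)

variable (R N)

/-- The retract argument: in a factorization of a trivial cofibration through `J`, the fibration is
trivial by two-out-of-three, so `i` is a retract of the first factor. -/
lemma llp_rlp_generatingTrivialCofibrations_eq :
    (generatingCofibrations R N).rlp.llp ⊓ quasiIso (ModuleCat.{u} R) N =
      (generatingTrivialCofibrations R N).rlp.llp := by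
  refine le_antisymm (fun A B i hi => ?_) (fun A B i hi => ⟨fun X Y p hp => hi p ?_,
    quasiIso_of_llp_rlp i hi⟩)
  · have d := MorphismProperty.factorizationData (generatingTrivialCofibrations R N).rlp.llp
      (generatingTrivialCofibrations R N).rlp i
    have := hi.1 d.p ((rlp_generatingCofibrations_iff _).2 ⟨d.hp,
      (quasiIso (ModuleCat.{u} R) N).of_precomp _ _ (quasiIso_of_llp_rlp _ d.hi)
        (by rw [d.fac]; exact hi.2)⟩)
    exact MorphismProperty.of_retract (RetractArrow.ofLeftLiftingProperty d.fac) d.hi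
  · exact ((rlp_generatingCofibrations_iff p).1 hp).1

/-- The model structure on the category of `N`-complexes of modules whose weak equivalences are
the `N`-quasi-isomorphisms and whose fibrations are the degreewise surjections. -/
@[reducible]
noncomputable def modelCategory : ModelCategory (NComplex (ModuleCat.{u} R) N) :=
  letI : CategoryWithFibrations (NComplex (ModuleCat.{u} R) N) :=
    ⟨(generatingTrivialCofibrations R N).rlp⟩
  letI : CategoryWithCofibrations (NComplex (ModuleCat.{u} R) N) :=
    ⟨(generatingCofibrations R N).rlp.llp⟩
  letI : CategoryWithWeakEquivalences (NComplex (ModuleCat.{u} R) N) :=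
    ⟨quasiIso (ModuleCat.{u} R) N⟩
  have : (weakEquivalences (NComplex (ModuleCat.{u} R) N)).HasTwoOutOfThreeProperty :=
    inferInstanceAs (quasiIso (ModuleCat.{u} R) N).HasTwoOutOfThreeProperty
  have h₁ : trivialFibrations (NComplex (ModuleCat.{u} R) N) = (generatingCofibrations R N).rlp :=
    (rlp_generatingCofibrations_eq R N).symm
  have h₂ : trivialCofibrations (NComplex (ModuleCat.{u} R) N) =
      (generatingTrivialCofibrations R N).rlp.llp :=
    llp_rlp_generatingTrivialCofibrations_eq R N
  have : MorphismProperty.IsWeakFactorizationSystem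
      (cofibrations (NComplex (ModuleCat.{u} R) N))
      (trivialFibrations (NComplex (ModuleCat.{u} R) N)) := by
    rw [h₁]
    exact { rlp := MorphismProperty.rlp_llp_rlp _
            llp := rfl
            hasFactorization := inferInstanceAs (MorphismProperty.HasFactorization
              (generatingCofibrations R N).rlp.llp (generatingCofibrations R N).rlp) }
  have : MorphismProperty.IsWeakFactorizationSystem
      (trivialCofibrations (NComplex (ModuleCat.{u} R) N))
      (fibrations (NComplex (ModuleCat.{u} R) N)) := by
    rw [h₂]
    exact { rlp := MorphismProperty.rlp_llp_rlp _
            llp := rfl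
            hasFactorization := inferInstanceAs (MorphismProperty.HasFactorization
              (generatingTrivialCofibrations R N).rlp.llp
              (generatingTrivialCofibrations R N).rlp) }
  have := hasLimits R N
  have := hasColimits R N
  ModelCategory.mk' _

attribute [local instance] modelCategory

variable {R N}

lemma isFibrant (X : NComplex (ModuleCat.{u} R) N) : IsFibrant X := by
  rw [isFibrant_iff, fibration_iff]
  refine (rlp_generatingTrivialCofibrations_iff _).2 fun i y => ⟨(0 : X.deg i), ?_⟩
  have h : IsZero (⊤_ NComplex (ModuleCat.{u} R) N) :=
    (isZero_zero _).of_iso (HasZeroObject.zeroIsoTerminal).symm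
  have h' : 𝟙 (⊤_ NComplex (ModuleCat.{u} R) N) = 0 := h.eq_of_src _ _
  rw [map_zero, ← component_id _ i y, h', component_zero]

lemma hProj_of_isCofibrant (X : NComplex (ModuleCat.{u} R) N) [IsCofibrant X] :
    hProj (ModuleCat.{u} R) N ((KN.proj (ModuleCat.{u} R) N).obj X) := by
  intro Y hY
  refine ⟨?_⟩
  suffices ∀ f : (KN.proj (ModuleCat.{u} R) N).obj X ⟶ (KN.proj (ModuleCat.{u} R) N).obj Y,
      f = 0 from fun f g => (this f).trans (this g).symm
  intro f
  obtain ⟨f, rfl⟩ := (KN.proj (ModuleCat.{u} R) N).map_surjective f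
  -- A surjection between acyclic complexes is a trivial fibration, so `f` lifts to a disk.
  have hp : (generatingCofibrations R N).rlp Y.fromDisk :=
    (rlp_generatingCofibrations_iff _).2
      ⟨(rlp_generatingTrivialCofibrations_iff _).2 fun i => Y.exists_fromDisk_eq i,
        quasiIso_of_acyclic _ (acyclic_disk N _) hY⟩
  have hX : (generatingCofibrations R N).rlp.llp (initial.to X) :=
    (cofibration_iff (initial.to X)).1 inferInstance
  have := hX _ hp
  have sq : CommSq (initial.to _) (initial.to X) Y.fromDisk f := ⟨by simp⟩
  rw [proj_map_eq_zero_iff]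
  exact ⟨_, splitProjective_disk N _, splitInjective_disk N _, sq.lift, Y.fromDisk, sq.fac_right⟩

lemma rightHomotopyRel_of_factorsThroughProjInj {X Y : NComplex (ModuleCat.{u} R) N} {f g : X ⟶ Y}
    (h : FactorsThroughProjInj (f - g)) : RightHomotopyRel f g := by
  obtain ⟨s, hs⟩ := (factorsThroughProjInj_iff _).1 h
  -- The two endpoint maps differ by `fromDisk` on the disk summand, so a homotopy from `f` to `g`
  -- amounts to a null-homotopy of `f - g`.
  let P : PathObject Y :=
    { P := Y ⊞ disk N (fun a => Y.deg (a - N + 1))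
      p₀ := biprod.desc (𝟙 Y) Y.fromDisk
      p₁ := biprod.fst
      ι := biprod.inl
      ι_p₀ := by simp
      ι_p₁ := by simp
      weakEquivalence_ι := by
        rw [weakEquivalence_iff]
        exact quasiIso_biprod_inl _ _ (acyclic_disk N _) }
  refine ⟨P, ⟨⟨biprod.lift g (diskLift s), ?_, ?_⟩⟩⟩
  · change biprod.lift g (diskLift s) ≫ biprod.desc (𝟙 Y) Y.fromDisk = f
    rw [biprod.lift_desc, ← hs, Category.comp_id]
    abel
  · exact biprod.lift_fst _ _

/-- In `K_N` the homotopy lifts along the quasi-isomorphism `P.ι` to some `w`, with which both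
endpoints then agree. -/
lemma factorsThroughProjInj_of_rightHomotopyRel {X Y : NComplex (ModuleCat.{u} R) N}
    [IsCofibrant X] {f g : X ⟶ Y} (h : RightHomotopyRel f g) : FactorsThroughProjInj (f - g) := by
  obtain ⟨P, ⟨h⟩⟩ := h
  obtain ⟨w, hw⟩ := hProj.exists_lift (hProj_of_isCofibrant X) P.ι
    ((weakEquivalence_iff P.ι).1 inferInstance) h.h
  have key : ∀ p : P.P ⟶ Y, P.ι ≫ p = 𝟙 Y → (KN.proj (ModuleCat.{u} R) N).map (h.h ≫ p) =
      (KN.proj (ModuleCat.{u} R) N).map w := fun p hp => by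
    rw [Functor.map_comp, ← hw, ← Functor.map_comp, Category.assoc, hp, Category.comp_id]
  have h' := (key P.p₀ P.ι_p₀).trans (key P.p₁ P.ι_p₁).symm
  rwa [h.h₀, h.h₁, proj_map_eq_iff] at h'

lemma homotopy_tfae {X Y : NComplex (ModuleCat.{u} R) N} (f g : X ⟶ Y) [IsCofibrant X] :
    [LeftHomotopyRel f g, RightHomotopyRel f g, (KN.proj (ModuleCat.{u} R) N).map (f - g) = 0,
      NComplex.Nullhomotopic (f - g)].TFAE := by
  have := isFibrant Y
  tfae_have 1 ↔ 2 := leftHomotopyRel_iff_rightHomotopyRel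
  tfae_have 3 ↔ 4 := by rw [proj_map_eq_zero_iff, nullhomotopic_iff]
  tfae_have 2 → 3 := fun h =>
    (proj_map_eq_zero_iff _).2 (factorsThroughProjInj_of_rightHomotopyRel h)
  tfae_have 3 → 2 := fun h =>
    rightHomotopyRel_of_factorsThroughProjInj ((proj_map_eq_zero_iff _).1 h)
  tfae_finish

/-! ### The homotopy category -/

variable (R N)

/-- The functor from bifibrant objects to h-projective objects induced by the identity. -/
noncomputable def bifibrantToHProj : BifibrantObject (NComplex (ModuleCat.{u} R) N) ⥤
    (hProj (ModuleCat.{u} R) N).FullSubcategory :=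
  (hProj (ModuleCat.{u} R) N).lift (BifibrantObject.ι ⋙ KN.proj (ModuleCat.{u} R) N)
    fun X => hProj_of_isCofibrant X.obj

/-- The functor from the homotopy category of bifibrant objects to h-projective objects induced
by the identity. -/
noncomputable def hoCatToHProj : BifibrantObject.HoCat (NComplex (ModuleCat.{u} R) N) ⥤
    (hProj (ModuleCat.{u} R) N).FullSubcategory :=
  CategoryTheory.Quotient.lift _ (bifibrantToHProj R N) fun _ _ f g h =>
    ObjectProperty.hom_ext _ ((proj_map_eq_iff f.hom g.hom).2
      (factorsThroughProjInj_of_rightHomotopyRel h))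

instance : (hoCatToHProj R N).Full where
  map_surjective := by
    rintro ⟨X⟩ ⟨Y⟩ ⟨f⟩
    obtain ⟨g, hg⟩ := (KN.proj (ModuleCat.{u} R) N).map_surjective f
    exact ⟨BifibrantObject.toHoCat.map ⟨g⟩, ObjectProperty.hom_ext _ hg⟩

instance : (hoCatToHProj R N).Faithful where
  map_injective := by
    rintro ⟨X⟩ ⟨Y⟩ f g h
    obtain ⟨f, rfl⟩ := BifibrantObject.toHoCat.map_surjective f
    obtain ⟨g, rfl⟩ := BifibrantObject.toHoCat.map_surjective g
    rw [BifibrantObject.toHoCat_map_eq_iff]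
    exact rightHomotopyRel_of_factorsThroughProjInj
      ((proj_map_eq_iff f.hom g.hom).1 (congrArg (fun f => f.hom) h))

instance : (hoCatToHProj R N).EssSurj where
  mem_essImage := by
    rintro ⟨⟨X⟩, hX⟩
    -- The preimage is a cofibrant replacement: its projection to `X` is a quasi-isomorphism between
    -- h-projectives.
    have d := MorphismProperty.factorizationData
      (cofibrations (NComplex (ModuleCat.{u} R) N))
      (trivialFibrations (NComplex (ModuleCat.{u} R) N)) (initial.to X)
    have : IsCofibrant d.Z := by
      rw [isCofibrant_iff, Subsingleton.elim (initial.to d.Z) d.i, cofibration_iff]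
      exact d.hi
    have := isFibrant d.Z
    have hp := hProj.isIso_proj_map (hProj_of_isCofibrant d.Z) hX d.p d.hp.2
    exact ⟨BifibrantObject.toHoCat.obj (BifibrantObject.mk d.Z),
      ⟨(hProj (ModuleCat.{u} R) N).isoMk (@asIso _ _ _ _ _ hp)⟩⟩

instance : (hoCatToHProj R N).IsEquivalence where

end Model

end NComplex

theorem mainTheorem11 (R : Type u) [Ring R] (N : ℕ) :
    ∃ _ : ModelCategory (NComplex (ModuleCat.{u} R) N),
      -- the model structure generated by `I`, `J` and `W`
      weakEquivalences (NComplex (ModuleCat.{u} R) N) = NComplex.quasiIso (ModuleCat.{u} R) N ∧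
      fibrations (NComplex (ModuleCat.{u} R) N) = (generatingTrivialCofibrations R N).rlp ∧
      cofibrations (NComplex (ModuleCat.{u} R) N) = (generatingCofibrations R N).rlp.llp ∧
      -- cofibrant objects are h-projective
      (∀ X : NComplex (ModuleCat.{u} R) N, IsCofibrant X →
        hProj (ModuleCat.{u} R) N ((KN.proj (ModuleCat.{u} R) N).obj X)) ∧
      -- for maps between cofibrant objects, model homotopy is `N`-homotopy
      (∀ (X Y : NComplex (ModuleCat.{u} R) N) (f g : X ⟶ Y), IsCofibrant X → IsCofibrant Y →
        [LeftHomotopyRel f g, RightHomotopyRel f g, (KN.proj (ModuleCat.{u} R) N).map (f - g) = 0,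
          NComplex.Nullhomotopic (f - g)].TFAE) ∧
      -- the functor induced by the identity is an equivalence
      ∃ F : BifibrantObject.HoCat (NComplex (ModuleCat.{u} R) N) ⥤
          (hProj (ModuleCat.{u} R) N).FullSubcategory,
        BifibrantObject.toHoCat ⋙ F ⋙ (hProj (ModuleCat.{u} R) N).ι =
          BifibrantObject.ι ⋙ KN.proj (ModuleCat.{u} R) N ∧
        F.IsEquivalence := by
  refine ⟨NComplex.modelCategory R N, rfl, rfl, rfl, fun X _ => NComplex.hProj_of_isCofibrant X,
    fun X Y f g _ _ => NComplex.homotopy_tfae f g, NComplex.hoCatToHProj R N, rfl, inferInstance⟩
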